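/- Let $d\in\mathbb N$, let $\mathcal L$ be Lebesgue measure on $\mathbb R^d$, and let $B(x,r)$ be the open Euclidean ball with centre $x$ and radius $r$. For $t\ge 0$ and $E\subset\mathbb R^d$ let $$\mathcal H^t_\infty(E):=\inf\Bigl\{\sum_{n=1}^\infty(\operatorname{diam}F_n)^t: E\subset\bigcup_{n=1}^\infty F_n\Bigr\}$$ be the $t$-dimensional Hausdorff content (empty $F_n$ contribute $0$, also for $t=0$). For a Lebesgue measurable set $F\subset\mathbb R^d$ with $0<\mathcal L(F)<\infty$ put $$I_t(F):=\iint_{F\times F}|x-y|^{-t}\,d\mathcal L(x)\,d\mathcal L(y)\in[0,\infty],\qquad g_t(F):=\frac{\mathcal L(F)^2}{I_t(F)}$$ (with $g_t(F)=0$ if $I_t(F)=\infty$), and for a bounded set $E\subset\mathbb R^d$ let $$G_t(E):=\sup\{g_t(F): F\subset E,\ F\text{ Lebesgue measurable},\ \mathcal L(F)>0\},\qquad \sup\emptyset:=0.$$ For a sequence $\mathbf A=(A_n)_{n\in\mathbb N}$ of bounded Lebesgue measurable subsets of $\mathbb R^d$ define $$t_0(\mathbf A):=\inf\Bigl\{0\le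 t\le d:\sum_{n=1}^\infty\mathcal H^t_\infty(A_n)<\infty\Bigr\},\qquad s_0(\mathbf A):=\sup\Bigl\{0\le s\le d:\sum_{n=1}^\infty G_s(A_n)=\infty\Bigr\},$$ with $\inf\emptyset:=d$ and $\sup\emptyset:=0$. Finally, for $E\subset\mathbb R^d$ let $$E^+:=\Bigl\{x\in E:\ \liminf_{r\to0}\frac{\mathcal L(E\cap B(x,r))}{\mathcal L(B(x,r))}>0\Bigr\}.$$ **Corollary 3.11.** Let $R>0$, and let $\mathbf A=(A_n)_{n\in\mathbb N}$ be a sequence of Lebesgue measurable subsets of $B(0,R)\subset\mathbb R^d$ such that $A_n^+=A_n$ for all $n\in\mathbb N$. Then $t_0(\mathbf A)=s_0(\mathbf A)$. -/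

import Mathlib

open MeasureTheory Filter Topology
open scoped ENNReal

namespace CoveringExponents

noncomputable section

/-- The `t`-dimensional Hausdorff content
`inf {∑ₙ (diam Fₙ)^t : E ⊆ ⋃ₙ Fₙ}`, the infimum being over all countable covers of `E`.
As usual an empty member of a cover contributes `0`, also when `t = 0`
(while a non-empty member contributes `1` when `t = 0`). -/
def hausdorffContent {d : ℕ} (t : ℝ) (E : Set (EuclideanSpace ℝ (Fin d))) : ℝ≥0∞ :=
  ⨅ (F : ℕ → Set (EuclideanSpace ℝ (Fin d))) (_ : E ⊆ ⋃ n, F n),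
    ∑' n, ⨆ _ : (F n).Nonempty, Metric.ediam (F n) ^ t

/-- The `t`-energy `I_t(F) = ∬_{F × F} |x - y|^{-t} dx dy` of a set, with values in `[0, ∞]`. -/
def setEnergy {d : ℕ} (t : ℝ) (F : Set (EuclideanSpace ℝ (Fin d))) : ℝ≥0∞ :=
  ∫⁻ x in F, ∫⁻ y in F, edist x y ^ (-t)

/-- `g_t(F) = L(F)² / I_t(F)`, used for Lebesgue measurable `F` of positive (finite) measure;
it is `0` if the energy is infinite. -/
def gFun {d : ℕ} (t : ℝ) (F : Set (EuclideanSpace ℝ (Fin d))) : ℝ≥0∞ :=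
  volume F ^ 2 / setEnergy t F

/-- `G_t(E)`, the supremum of `g_t(F)` over the Lebesgue measurable subsets `F` of `E` of positive
measure, with `sup ∅ = 0`. (`NullMeasurableSet F volume` is Lebesgue measurability.) -/
def GFun {d : ℕ} (t : ℝ) (E : Set (EuclideanSpace ℝ (Fin d))) : ℝ≥0∞ :=
  ⨆ (F : Set (EuclideanSpace ℝ (Fin d)))
    (_ : F ⊆ E ∧ NullMeasurableSet F volume ∧ 0 < volume F), gFun t F

open Classical in
/-- The content exponent `t₀(A) = inf {0 ≤ t ≤ d : ∑ₙ H^t_∞(Aₙ) < ∞}`, with `inf ∅ = d`. -/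
def contentExponent {d : ℕ} (A : ℕ → Set (EuclideanSpace ℝ (Fin d))) : ℝ :=
  if {t : ℝ | 0 ≤ t ∧ t ≤ d ∧ ∑' n, hausdorffContent t (A n) < ∞}.Nonempty then
    sInf {t : ℝ | 0 ≤ t ∧ t ≤ d ∧ ∑' n, hausdorffContent t (A n) < ∞}
  else d

/-- The energy exponent `s₀(A) = sup {0 ≤ s ≤ d : ∑ₙ G_s(Aₙ) = ∞}`, with `sup ∅ = 0`
(which is the value of `sSup ∅` in `ℝ`; the set is bounded above by `d`). -/
def energyExponent {d : ℕ} (A : ℕ → Set (EuclideanSpace ℝ (Fin d))) : ℝ :=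
  sSup {s : ℝ | 0 ≤ s ∧ s ≤ d ∧ ∑' n, GFun s (A n) = ∞}

/-- `E⁺`, the set of the points of `E` at which `E` has positive lower Lebesgue density. -/
def positiveDensityPart {d : ℕ} (E : Set (EuclideanSpace ℝ (Fin d))) :
    Set (EuclideanSpace ℝ (Fin d)) :=
  {x | x ∈ E ∧ 0 < liminf
    (fun r : ℝ => volume (E ∩ Metric.ball x r) / volume (Metric.ball x r)) (𝓝[>] 0)}

end

end CoveringExponents

/-!
Let `k(x, y) = |x - y|^{-s}`. The two exponents agree because, for sets in a fixed ball, the content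
`H^t` and the energy capacity `G_s` control each other up to an arbitrarily small change of exponent.

*Capacity by content.* If `F ⊆ E` is covered by sets `Cₙ`, made disjoint, then the energy of `F` is at
least `∑ L(F ∩ Cₙ)² (diam Cₙ)^{-s}`, so the Cauchy-Schwarz inequality gives
`g_s(F) ≤ ∑ (diam Cₙ)^s` (`gFun_le_tsum_of_subset_iUnion`). No density assumption is needed.

*Content by capacity*, for `s < t` and `E = E⁺` (`exists_hausdorffContent_le_mul_GFun`). A
probability measure `μ` of bounded density on `E` can be imitated, at a very small scale, by normalized
Lebesgue measure on a subset of `E`, so its energy is at least a constant times `1 / G_s(E)`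
(`one_le_GFun_mul_mutualEnergy`). Given finitely many subsets `S` of `E` of positive measure, let `μ`
have least energy among the convex combinations of the uniform measures on the `S`. By the first-order
condition for a minimum the potential of `μ` has mean at least that energy over every `S`
(`exists_convexCombination_energy_le`). Let the finite family grow, and let `m` be the limit of the
masses along an ultrafilter. This `m` is only finitely additive, which suffices.

Fix `x ∈ E` and test with `S = E ∩ B(x, ρ)` for a small `ρ`. If `m(B(x, r)) < κ r^t / G_s(E)` for
all dyadic radii `r`, then the mean potential over `S` is at most a geometric sum proportional to
`κ / G_s(E)` plus a term of size `O(ρ^{t - s})`, whose constant depends on the lower density of `E` at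
`x`; the latter disappears as `ρ → 0`, and a suitable `κ` independent of `x` yields a contradiction
(`exists_le_mass_closedBall`). So every `x ∈ E` is the centre of a ball with
`r^t ≤ C G_s(E) m(B(x, r))`, and Vitali's covering theorem bounds `H^t(E)` by a multiple of `G_s(E)`
(`hausdorffContent_le_of_forall_exists_closedBall`).
-/

namespace CoveringExponents

/-! ### Hausdorff content bounds the energy capacity -/

theorem sq_tsum_mul_le (u v : ℕ → ℝ≥0∞) :
    (∑' n, u n * v n) ^ 2 ≤ (∑' n, u n ^ 2) * ∑' n, v n ^ 2 := by
  have h := ENNReal.lintegral_mul_le_Lp_mul_Lq (Measure.count : Measure ℕ)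
    (Real.HolderConjugate.two_two) (f := u) (g := v)
    (measurable_of_countable u).aemeasurable (measurable_of_countable v).aemeasurable
  simp only [lintegral_count, Pi.mul_apply, ENNReal.rpow_two] at h
  calc (∑' n, u n * v n) ^ 2
      ≤ ((∑' n, u n ^ 2) ^ (1 / 2 : ℝ) * (∑' n, v n ^ 2) ^ (1 / 2 : ℝ)) ^ 2 := by gcongr
    _ = _ := by
      rw [mul_pow, ← ENNReal.rpow_two, ← ENNReal.rpow_two, ← ENNReal.rpow_mul,
        ← ENNReal.rpow_mul]
      norm_num

theorem measurable_edist_rpow {d : ℕ} (s : ℝ) :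
    Measurable fun p : EuclideanSpace ℝ (Fin d) × EuclideanSpace ℝ (Fin d) =>
      edist p.1 p.2 ^ s := by
  fun_prop

theorem sq_tsum_le_of_mul_le {u w e : ℕ → ℝ≥0∞} (he : ∑' n, e n ≠ ∞)
    (hw : ∀ n, w n ≠ ∞) (h : ∀ n, u n ^ 2 * (w n)⁻¹ ≤ e n) :
    (∑' n, u n) ^ 2 ≤ (∑' n, e n) * ∑' n, w n := by
  have hsq : ∀ x : ℝ≥0∞, (x ^ (1 / 2 : ℝ)) ^ 2 = x := fun x => by
    rw [← ENNReal.rpow_two, ← ENNReal.rpow_mul]; norm_num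
  have hle : ∀ n, u n ≤ e n ^ (1 / 2 : ℝ) * w n ^ (1 / 2 : ℝ) := by
    intro n
    rw [← ENNReal.mul_rpow_of_nonneg _ _ (by norm_num : (0 : ℝ) ≤ 1 / 2)]
    have hu : u n ^ 2 ≤ e n * w n := by
      by_cases h0 : w n = 0
      · have hn : e n ≠ ∞ := ENNReal.ne_top_of_tsum_ne_top he n
        have := h n
        rw [h0, ENNReal.inv_zero] at this
        by_cases hu0 : u n ^ 2 = 0
        · rw [hu0]; exact zero_le
        · rw [ENNReal.mul_top hu0] at this
          exact absurd (top_le_iff.1 this) hn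
      · rw [← ENNReal.div_le_iff h0 (hw n), div_eq_mul_inv]
        exact h n
    calc u n = (u n ^ 2) ^ (1 / 2 : ℝ) := by
          rw [← ENNReal.rpow_two, ← ENNReal.rpow_mul]; norm_num
      _ ≤ _ := by gcongr
  calc (∑' n, u n) ^ 2 ≤ (∑' n, e n ^ (1 / 2 : ℝ) * w n ^ (1 / 2 : ℝ)) ^ 2 := by
        gcongr; exact hle _
    _ ≤ _ := by
        refine (sq_tsum_mul_le _ _).trans ?_
        simp only [hsq, le_refl]

theorem sq_measure_mul_ediam_le_lintegral {d : ℕ}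
    (μ : Measure (EuclideanSpace ℝ (Fin d))) {s : ℝ} (hs : 0 < s)
    {D C : Set (EuclideanSpace ℝ (Fin d))} (hD : MeasurableSet D) (hDC : D ⊆ C) :
    μ D ^ 2 * (Metric.ediam C ^ s)⁻¹ ≤ ∫⁻ x in D, ∫⁻ y, edist x y ^ (-s) ∂μ ∂μ := by
  calc μ D ^ 2 * (Metric.ediam C ^ s)⁻¹
      = ∫⁻ _ in D, ∫⁻ _ in D, (Metric.ediam C ^ s)⁻¹ ∂μ ∂μ := by
        simp only [lintegral_const, Measure.restrict_apply MeasurableSet.univ, Set.univ_inter]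
        ring
    _ ≤ ∫⁻ x in D, ∫⁻ y in D, edist x y ^ (-s) ∂μ ∂μ := by
        refine setLIntegral_mono' hD fun x hx => setLIntegral_mono' hD fun y hy => ?_
        rw [ENNReal.rpow_neg]
        gcongr
        exact Metric.edist_le_ediam_of_mem (hDC hx) (hDC hy)
    _ ≤ _ := by
        gcongr
        exact Measure.restrict_le_self

theorem gFun_le_tsum_of_subset_iUnion {d : ℕ} {s : ℝ} (hs : 0 < s)
    {F : Set (EuclideanSpace ℝ (Fin d))}
    {C : ℕ → Set (EuclideanSpace ℝ (Fin d))} (hC : F ⊆ ⋃ n, C n) :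
    gFun s F ≤ ∑' n, Metric.ediam (C n) ^ s := by
  by_cases hI : setEnergy s F = ∞
  · simp [gFun, hI]
  by_cases hw : ∃ n, Metric.ediam (C n) ^ s = ∞
  · obtain ⟨n, hn⟩ := hw
    rw [ENNReal.tsum_eq_top_of_eq_top ⟨n, hn⟩]
    exact le_top
  push Not at hw
  -- Replacing the members of the cover by their closures makes them measurable.
  set D := disjointed fun n => closure (C n) with hD
  have hDm : ∀ n, MeasurableSet (D n) :=
    MeasurableSet.disjointed fun n => isClosed_closure.measurableSet
  have hDU : ⋃ n, D n = ⋃ n, closure (C n) := iUnion_disjointed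
  set μ := (volume : Measure (EuclideanSpace ℝ (Fin d))).restrict F with hμ
  have hdisj : Pairwise (Function.onFun Disjoint D) := disjoint_disjointed _
  have hsub : F ⊆ ⋃ n, D n := by
    rw [hDU]; exact hC.trans (Set.iUnion_mono fun n => subset_closure)
  have hvol : volume F = ∑' n, μ (D n) := by
    rw [← measure_iUnion hdisj hDm, hμ, Measure.restrict_apply (MeasurableSet.iUnion hDm),
      Set.inter_eq_right.2 hsub]
  set e : ℕ → ℝ≥0∞ := fun n => ∫⁻ x in D n, ∫⁻ y, edist x y ^ (-s) ∂μ ∂μ with he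
  have hen : ∑' n, e n ≤ setEnergy s F := by
    rw [he, ← lintegral_iUnion hDm hdisj]
    exact setLIntegral_le_lintegral _ _
  have hfin : ∑' n, e n ≠ ∞ := ne_top_of_le_ne_top hI hen
  have key : volume F ^ 2 ≤ setEnergy s F * ∑' n, Metric.ediam (C n) ^ s := by
    rw [hvol]
    refine (sq_tsum_le_of_mul_le hfin hw fun n => ?_).trans (by gcongr)
    rw [← Metric.ediam_closure]
    exact sq_measure_mul_ediam_le_lintegral μ hs (hDm n) (disjointed_subset _ _)
  rw [gFun, mul_comm] at *
  exact ENNReal.div_le_of_le_mul key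

/-- For `t < s` the content `H^t` of a bounded set controls its `s`-energy capacity: this is the
inequality behind `energyExponent A ≤ contentExponent A`. -/
theorem GFun_le_mul_hausdorffContent {d : ℕ} {s t : ℝ} (ht : 0 ≤ t) (hts : t < s)
    {E : Set (EuclideanSpace ℝ (Fin d))} {D : ℝ≥0∞} (hD0 : D ≠ 0) (hD : D ≠ ∞)
    (hE : Metric.ediam E ≤ D) :
    GFun s E ≤ D ^ (s - t) * hausdorffContent t E := by
  have hs : 0 < s := ht.trans_lt hts
  have hst : 0 < s - t := sub_pos.2 hts
  have h0 : D ^ (s - t) ≠ 0 := (ENNReal.rpow_pos hD0.bot_lt hD).ne'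
  have h1 : D ^ (s - t) ≠ ∞ := ENNReal.rpow_ne_top_of_nonneg hst.le hD
  refine iSup₂_le fun F hF => ?_
  simp only [hausdorffContent, ENNReal.mul_iInf_of_ne h0 h1]
  refine le_iInf₂ fun C hC => ?_
  have hFC : F ⊆ ⋃ n, C n ∩ E := by
    rw [← Set.iUnion_inter]
    exact Set.subset_inter (hF.1.trans hC) hF.1
  refine (gFun_le_tsum_of_subset_iUnion hs hFC).trans ?_
  rw [← ENNReal.tsum_mul_left]
  refine ENNReal.tsum_le_tsum fun n => ?_
  rcases (C n).eq_empty_or_nonempty with h | h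
  · simp [h, hs]
  · rw [iSup_pos h]
    calc Metric.ediam (C n ∩ E) ^ s
        = Metric.ediam (C n ∩ E) ^ (s - t) * Metric.ediam (C n ∩ E) ^ t := by
          rw [← ENNReal.rpow_add_of_nonneg _ _ hst.le ht, sub_add_cancel]
      _ ≤ D ^ (s - t) * Metric.ediam (C n) ^ t := by
          gcongr
          · exact (Metric.ediam_mono Set.inter_subset_right).trans hE
          · exact Set.inter_subset_left

/-! ### Local integrability of the Riesz kernel -/

/-- The Riesz kernel of order `s < d` has integral `O(r ^ (d - s))` over balls of radius `r`. -/
theorem exists_setLIntegral_ball_edist_rpow_le {d : ℕ} {s : ℝ} (hs : 0 ≤ s) (hsd : s < d) :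
    ∃ C : ℝ≥0∞, C ≠ ∞ ∧ ∀ (z : EuclideanSpace ℝ (Fin d)) (r : ℝ), 0 < r →
      ∫⁻ y in Metric.ball z r, edist y z ^ (-s) ≤ C * ENNReal.ofReal (r ^ (d - s)) := by
  have hd : 0 < (d : ℝ) := hs.trans_lt hsd
  have : NeZero d := ⟨by rintro rfl; simp at hd⟩
  set v := volume (Metric.ball (0 : EuclideanSpace ℝ (Fin d)) 1) with hv
  have hvt : v ≠ ∞ := measure_ball_lt_top.ne
  set q : ℝ := 2 ^ (-(d - s)) with hq
  have hq1 : q < 1 := Real.rpow_lt_one_of_one_lt_of_neg one_lt_two (by linarith)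
  have hq0 : 0 ≤ q := by positivity
  refine ⟨ENNReal.ofReal (2 ^ s) * (1 - ENNReal.ofReal q)⁻¹ * v, ?_, fun z r hr => ?_⟩
  · refine ENNReal.mul_ne_top (ENNReal.mul_ne_top ENNReal.ofReal_ne_top ?_) hvt
    rw [ENNReal.inv_ne_top]
    exact (tsub_pos_of_lt (by simpa using hq1)).ne'
  set ρ : ℕ → ℝ := fun k => r * (2⁻¹) ^ k with hρ
  have hρ0 : ∀ k, 0 < ρ k := fun k => by positivity
  set Z : ℕ → Set (EuclideanSpace ℝ (Fin d)) := fun k =>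
    Metric.ball z (ρ k) \ Metric.ball z (ρ (k + 1)) with hZ
  have hcov : Metric.ball z r \ {z} ⊆ ⋃ k, Z k := by
    rintro y ⟨hy, hyz⟩
    have hpos : 0 < dist y z := dist_pos.2 hyz
    have hlim : Tendsto ρ atTop (𝓝 (r * 0)) :=
      (tendsto_pow_atTop_nhds_zero_of_lt_one (by norm_num) (by norm_num)).const_mul r
    rw [mul_zero] at hlim
    classical
    have hex : ∃ k, ρ k ≤ dist y z :=
      ((hlim.eventually (gt_mem_nhds hpos)).exists).imp fun _ h => le_of_lt h
    have hk := Nat.find_spec hex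
    rcases hn : Nat.find hex with _ | m
    · rw [hn] at hk
      simp only [hρ, pow_zero, mul_one] at hk
      exact absurd (Metric.mem_ball.1 hy) (not_lt.2 hk)
    · refine Set.mem_iUnion.2 ⟨m, ?_, ?_⟩
      · have := Nat.find_min hex (m := m) (by omega)
        exact Metric.mem_ball.2 (not_le.1 this)
      · rw [hn] at hk
        simpa using hk
  have hterm : ∀ k, ∫⁻ y in Z k, edist y z ^ (-s) ≤
      ENNReal.ofReal (2 ^ s) * v * ENNReal.ofReal (r ^ (d - s)) * ENNReal.ofReal q ^ k := by
    intro k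
    have hb : ∀ y ∈ Z k, edist y z ^ (-s) ≤ ENNReal.ofReal (ρ (k + 1) ^ (-s)) := by
      intro y hy
      have h1 : ρ (k + 1) ≤ dist y z := by simpa using hy.2
      rw [edist_dist, ENNReal.ofReal_rpow_of_pos ((hρ0 _).trans_le h1)]
      exact ENNReal.ofReal_le_ofReal
        (Real.rpow_le_rpow_of_nonpos (hρ0 _) h1 (by linarith))
    calc ∫⁻ y in Z k, edist y z ^ (-s)
        ≤ ∫⁻ _ in Z k, ENNReal.ofReal (ρ (k + 1) ^ (-s)) :=
          setLIntegral_mono measurable_const hb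
      _ ≤ ENNReal.ofReal (ρ (k + 1) ^ (-s)) * volume (Metric.ball z (ρ k)) := by
          rw [setLIntegral_const]; gcongr; exact Set.sdiff_subset
      _ = ENNReal.ofReal (ρ (k + 1) ^ (-s) * ρ k ^ (d : ℝ)) * v := by
          rw [Measure.addHaar_ball_of_pos _ _ (hρ0 k), finrank_euclideanSpace_fin,
            Real.rpow_natCast, ENNReal.ofReal_mul (by positivity), mul_assoc]
      _ = ENNReal.ofReal (2 ^ s * r ^ (d - s) * q ^ k) * v := by
          congr 2
          have h2 : ρ (k + 1) = 2⁻¹ * ρ k := by simp only [hρ]; ring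
          have h3 : q ^ k = ((2⁻¹ : ℝ) ^ k) ^ (d - s) := by
            rw [hq, Real.rpow_neg zero_le_two, ← Real.inv_rpow zero_le_two, ← Real.rpow_natCast,
              ← Real.rpow_natCast, ← Real.rpow_mul (by norm_num), ← Real.rpow_mul (by norm_num),
              mul_comm]
          rw [h2, Real.mul_rpow (by norm_num) (hρ0 k).le, mul_assoc, ← Real.rpow_add (hρ0 k), h3,
            mul_assoc, ← Real.mul_rpow hr.le (by positivity),
            Real.inv_rpow zero_le_two, Real.rpow_neg zero_le_two, inv_inv, neg_add_eq_sub]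
      _ = _ := by
          rw [ENNReal.ofReal_mul (by positivity), ENNReal.ofReal_mul (by positivity),
            ENNReal.ofReal_pow hq0]
          ring
  calc ∫⁻ y in Metric.ball z r, edist y z ^ (-s)
      = ∫⁻ y in Metric.ball z r \ {z}, edist y z ^ (-s) :=
        (setLIntegral_congr (sdiff_null_ae_eq_self (measure_singleton z))).symm
    _ ≤ ∫⁻ y in ⋃ k, Z k, edist y z ^ (-s) := lintegral_mono_set hcov
    _ ≤ ∑' k, ∫⁻ y in Z k, edist y z ^ (-s) := lintegral_iUnion_le _ _
    _ ≤ ∑' k, ENNReal.ofReal (2 ^ s) * v * ENNReal.ofReal (r ^ (d - s)) *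
          ENNReal.ofReal q ^ k := ENNReal.tsum_le_tsum hterm
    _ = _ := by
        rw [ENNReal.tsum_mul_left, ENNReal.tsum_geometric]
        ring

/-! ### Subsets of prescribed measure -/

/-- Lebesgue measure is non-atomic: a measurable subset of a ball contains measurable subsets of
every smaller measure. -/
theorem exists_measurable_subset_volume_eq {d : ℕ} (hd : 0 < d)
    {S : Set (EuclideanSpace ℝ (Fin d))} (hS : MeasurableSet S) {R : ℝ}
    (hSR : S ⊆ Metric.ball 0 R) {c : ℝ≥0∞} (hc : c ≤ volume S) :
    ∃ T ⊆ S, MeasurableSet T ∧ volume T = c := by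
  have : NeZero d := ⟨hd.ne'⟩
  have hSt : volume S ≠ ∞ := ((measure_mono hSR).trans_lt measure_ball_lt_top).ne
  set g : ℝ → ℝ := fun r => (volume.restrict S).real (Metric.closedBall 0 r) with hg
  have hgc : Continuous g := by
    have hgi : g = fun r => ∫ x in S,
        (Metric.closedBall (0 : EuclideanSpace ℝ (Fin d)) r).indicator (fun _ => (1 : ℝ)) x := by
      ext r
      rw [integral_indicator Metric.isClosed_closedBall.measurableSet]
      simp [hg]
    rw [hgi]
    refine continuous_iff_continuousAt.2 fun r => ?_
    have : IsFiniteMeasure (volume.restrict S) := ⟨by simpa using hSt.lt_top⟩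
    refine continuousAt_of_dominated (bound := fun _ => 1) ?_ ?_ (integrable_const _) ?_
    · exact Eventually.of_forall fun r' => (measurable_const.indicator
        Metric.isClosed_closedBall.measurableSet).aestronglyMeasurable
    · refine Eventually.of_forall fun r' => Eventually.of_forall fun x => ?_
      by_cases hx : x ∈ Metric.closedBall (0 : EuclideanSpace ℝ (Fin d)) r' <;> simp [hx]
    · have hsph : ∀ᵐ x ∂(volume.restrict S), ‖x‖ ≠ r := by
        refine ae_restrict_of_ae ?_
        have := Measure.addHaar_sphere (volume : Measure (EuclideanSpace ℝ (Fin d))) 0 r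
        filter_upwards [measure_eq_zero_iff_ae_notMem.1 this] with x hx
        simpa using hx
      filter_upwards [hsph] with x hx
      rcases lt_or_gt_of_ne hx with h | h
      · refine (continuousAt_const (y := (1 : ℝ))).congr ?_
        filter_upwards [lt_mem_nhds h] with r' hr'
        rw [Set.indicator_of_mem]; simpa using hr'.le
      · refine (continuousAt_const (y := (0 : ℝ))).congr ?_
        filter_upwards [gt_mem_nhds h] with r' hr'
        rw [Set.indicator_of_notMem]; simpa using hr'
  have hneg : g (-1) = 0 := by
    simp [hg]
  have hRv : g R = (volume S).toReal := by
    simp only [hg, Measure.real]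
    rw [Measure.restrict_apply Metric.isClosed_closedBall.measurableSet, Set.inter_eq_right.2
      (hSR.trans Metric.ball_subset_closedBall)]
  have hct : c ≠ ∞ := ne_top_of_le_ne_top hSt hc
  obtain ⟨r, hr⟩ : c.toReal ∈ Set.range g :=
    mem_range_of_exists_le_of_exists_ge hgc ⟨-1, by rw [hneg]; positivity⟩
      ⟨R, by rw [hRv]; exact ENNReal.toReal_mono hSt hc⟩
  refine ⟨Metric.closedBall 0 r ∩ S, Set.inter_subset_right,
    Metric.isClosed_closedBall.measurableSet.inter hS, ?_⟩
  rw [← Measure.restrict_apply Metric.isClosed_closedBall.measurableSet]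
  refine (ENNReal.toReal_eq_toReal_iff' ?_ hct).1 hr
  exact ne_top_of_le_ne_top hSt ((measure_mono (Set.subset_univ _)).trans (by simp))

/-! ### Mutual energy and measures of least energy -/

/-- The mutual energy `∬ |x - y|^{-s} dμ(x) dν(y)` of two measures. -/
noncomputable def mutualEnergy {d : ℕ} (s : ℝ) (μ ν : Measure (EuclideanSpace ℝ (Fin d))) :
    ℝ≥0∞ :=
  ∫⁻ x, ∫⁻ y, edist x y ^ (-s) ∂ν ∂μ

theorem mutualEnergy_comm {d : ℕ} (s : ℝ) (μ ν : Measure (EuclideanSpace ℝ (Fin d)))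
    [SFinite μ] [SFinite ν] : mutualEnergy s μ ν = mutualEnergy s ν μ := by
  rw [mutualEnergy, lintegral_lintegral_swap (measurable_edist_rpow (-s)).aemeasurable]
  simp only [mutualEnergy, edist_comm]

theorem mutualEnergy_sum_smul_left {d : ℕ} (s : ℝ) {ι : Type*} [Fintype ι] (a : ι → ℝ≥0∞)
    (ν : ι → Measure (EuclideanSpace ℝ (Fin d))) (ρ : Measure (EuclideanSpace ℝ (Fin d))) :
    mutualEnergy s (∑ i, a i • ν i) ρ = ∑ i, a i * mutualEnergy s (ν i) ρ := by
  simp only [mutualEnergy, lintegral_finsetSum_measure, lintegral_smul_measure, smul_eq_mul]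

/-- A minimizer of a symmetric quadratic form on the standard simplex satisfies the first-order
optimality condition: its potential is everywhere at least its energy. -/
theorem exists_stdSimplex_forall_energy_le {ι : Type*} [Fintype ι] [Nonempty ι]
    {k : ι → ι → ℝ} (hk : ∀ i j, k i j = k j i) :
    ∃ a ∈ stdSimplex ℝ ι, ∀ j, ∑ i, a i * ∑ l, k i l * a l ≤ ∑ i, k j i * a i := by
  classical
  set Q : (ι → ℝ) → ℝ := fun a => ∑ i, a i * ∑ l, k i l * a l with hQ
  have hQc : Continuous Q := by fun_prop
  obtain ⟨a, ha, hmin⟩ := (isCompact_stdSimplex ℝ ι).exists_isMinOn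
    ⟨_, single_mem_stdSimplex ℝ (Classical.arbitrary ι)⟩ hQc.continuousOn
  refine ⟨a, ha, fun j => ?_⟩
  by_contra! hlt
  set A := ∑ i, a i * ∑ l, k i l * a l with hA
  set B := ∑ i, k j i * a i with hB
  set D := k j j - 2 * B + A with hD
  set e : ι → ℝ := Pi.single j 1 with he
  have hexp : ∀ h : ℝ, Q (a + h • (e - a)) = A + 2 * h * (B - A) + h ^ 2 * D := by
    intro h
    have hpot : ∀ i, ∑ l, k i l * (a + h • (e - a)) l
        = (1 - h) * ∑ l, k i l * a l + h * k i j := by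
      intro i
      have : ∀ l, k i l * (a + h • (e - a)) l = (1 - h) * (k i l * a l) + h * (k i l * e l) := by
        intro l; simp only [Pi.add_apply, Pi.smul_apply, Pi.sub_apply, smul_eq_mul]; ring
      simp only [this, Finset.sum_add_distrib, ← Finset.mul_sum]
      simp [he, Pi.single_apply]
    have hBA : ∑ i, a i * k i j = B := by
      rw [hB]; exact Finset.sum_congr rfl fun i _ => by rw [hk i j]; ring
    have : ∀ i, (a + h • (e - a)) i * ∑ l, k i l * (a + h • (e - a)) l =
        (1 - h) ^ 2 * (a i * ∑ l, k i l * a l) + (1 - h) * h * (a i * k i j)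
        + h * (1 - h) * (e i * ∑ l, k i l * a l) + h ^ 2 * (e i * k i j) := by
      intro i
      rw [hpot]; simp only [Pi.add_apply, Pi.smul_apply, Pi.sub_apply, smul_eq_mul]; ring
    simp only [hQ, this, Finset.sum_add_distrib, ← Finset.mul_sum, hBA, ← hA]
    have h1 : ∑ i, e i * ∑ l, k i l * a l = B := by simp [he, Pi.single_apply, hB]
    have h2 : ∑ i, e i * k i j = k j j := by simp [he, Pi.single_apply]
    rw [h1, h2, hD]; ring
  set h : ℝ := min 1 ((A - B) / (|D| + 1)) with hh
  have hpos : 0 < h := lt_min one_pos (div_pos (by linarith) (by positivity))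
  have hmem : a + h • (e - a) ∈ stdSimplex ℝ ι := by
    have := (convex_stdSimplex ℝ ι) ha (single_mem_stdSimplex ℝ j)
      (sub_nonneg.2 (min_le_left _ _ : h ≤ 1)) hpos.le (by ring)
    convert this using 1
    rw [sub_smul, smul_sub, one_smul]; abel
  have hle : A ≤ Q (a + h • (e - a)) := hmin hmem
  rw [hexp] at hle
  have hhD : h * (|D| + 1) ≤ A - B := by
    rw [← le_div_iff₀ (by positivity)]; exact min_le_right _ _
  have h3 : h ^ 2 * D ≤ h * (A - B) := by
    have : h * D ≤ A - B := by nlinarith [le_abs_self D]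
    nlinarith
  nlinarith

/-- Among the convex combinations of finitely many probability measures, one of least energy has a
potential whose mean against each of the given measures is at least the energy. -/
theorem exists_convexCombination_energy_le {d : ℕ} {s : ℝ} {ι : Type*} [Fintype ι] [Nonempty ι]
    (ν : ι → Measure (EuclideanSpace ℝ (Fin d))) [∀ i, IsProbabilityMeasure (ν i)]
    (hfin : ∀ i j, mutualEnergy s (ν i) (ν j) ≠ ∞) :
    ∃ a : ι → ℝ≥0∞, ∑ i, a i = 1 ∧ ∀ j,
      mutualEnergy s (∑ i, a i • ν i) (∑ i, a i • ν i)
        ≤ mutualEnergy s (ν j) (∑ i, a i • ν i) := by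
  obtain ⟨a, ⟨ha0, ha1⟩, hle⟩ := exists_stdSimplex_forall_energy_le
    (k := fun i j => (mutualEnergy s (ν i) (ν j)).toReal)
    fun i j => by rw [mutualEnergy_comm]
  have hsf : SFinite (∑ i, ENNReal.ofReal (a i) • ν i) := by
    rw [← Measure.sum_fintype]
    infer_instance
  have hpot : ∀ j, mutualEnergy s (ν j) (∑ i, ENNReal.ofReal (a i) • ν i)
      = ENNReal.ofReal (∑ i, (mutualEnergy s (ν j) (ν i)).toReal * a i) := by
    intro j
    rw [mutualEnergy_comm, mutualEnergy_sum_smul_left,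
      ENNReal.ofReal_sum_of_nonneg fun i _ => mul_nonneg ENNReal.toReal_nonneg (ha0 i)]
    refine Finset.sum_congr rfl fun i _ => ?_
    rw [ENNReal.ofReal_mul ENNReal.toReal_nonneg, ENNReal.ofReal_toReal (hfin _ _), mul_comm,
      mutualEnergy_comm]
  refine ⟨fun i => ENNReal.ofReal (a i), ?_, fun j => ?_⟩
  · rw [← ENNReal.ofReal_sum_of_nonneg fun i _ => ha0 i, ha1, ENNReal.ofReal_one]
  · rw [mutualEnergy_sum_smul_left, hpot]
    simp only [hpot, ← ENNReal.ofReal_mul (ha0 _)]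
    rw [← ENNReal.ofReal_sum_of_nonneg fun i _ => mul_nonneg (ha0 i) (Finset.sum_nonneg
      fun l _ => mul_nonneg ENNReal.toReal_nonneg (ha0 l))]
    exact ENNReal.ofReal_le_ofReal (hle j)

theorem mutualEnergy_ne_top_of_le {d : ℕ} {s : ℝ} (hs : 0 ≤ s) (hsd : s < d)
    {E : Set (EuclideanSpace ℝ (Fin d))} {R : ℝ} (hR : 0 < R)
    (hER : E ⊆ Metric.ball 0 R) {μ ν : Measure (EuclideanSpace ℝ (Fin d))} {M N : ℝ≥0∞}
    (hM : M ≠ ∞) (hN : N ≠ ∞) (hμ : μ ≤ M • volume.restrict E)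
    (hν : ν ≤ N • volume.restrict E) :
    mutualEnergy s μ ν ≠ ∞ := by
  obtain ⟨C, hC, hCle⟩ := exists_setLIntegral_ball_edist_rpow_le (d := d) hs hsd
  have hb : ∀ x ∈ E, ∫⁻ y, edist x y ^ (-s) ∂ν ≤
      N * (C * ENNReal.ofReal ((2 * R) ^ (d - s))) := by
    intro x hx
    calc ∫⁻ y, edist x y ^ (-s) ∂ν ≤ ∫⁻ y, edist x y ^ (-s) ∂(N • volume.restrict E) := by gcongr
      _ = N * ∫⁻ y in E, edist y x ^ (-s) := by
        simp only [lintegral_smul_measure, smul_eq_mul, edist_comm x]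
      _ ≤ N * ∫⁻ y in Metric.ball x (2 * R), edist y x ^ (-s) := by
        gcongr
        intro y hy
        have h1 := Metric.mem_ball.1 (hER hx)
        have h2 := Metric.mem_ball.1 (hER hy)
        rw [Metric.mem_ball]
        linarith [dist_triangle_right y x 0]
      _ ≤ _ := by gcongr; exact hCle _ _ (by positivity)
  have hvol : volume E ≠ ∞ := ((measure_mono hER).trans_lt measure_ball_lt_top).ne
  refine ne_top_of_le_ne_top (b := M * (N * (C * ENNReal.ofReal ((2 * R) ^ (d - s))) * volume E))
    (by finiteness) ?_
  calc mutualEnergy s μ ν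
      ≤ ∫⁻ x, ∫⁻ y, edist x y ^ (-s) ∂ν ∂(M • volume.restrict E) := by
        rw [mutualEnergy]; gcongr
    _ = M * ∫⁻ x in E, ∫⁻ y, edist x y ^ (-s) ∂ν := by
        rw [lintegral_smul_measure, smul_eq_mul]
    _ ≤ M * ∫⁻ _ in E, N * (C * ENNReal.ofReal ((2 * R) ^ (d - s))) := by
        gcongr 1
        exact setLIntegral_mono measurable_const hb
    _ = _ := by rw [setLIntegral_const]

theorem mutualEnergy_self_ne_zero {d : ℕ} {s : ℝ} (hs : 0 ≤ s)
    {E : Set (EuclideanSpace ℝ (Fin d))} {R : ℝ}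
    (hER : E ⊆ Metric.ball 0 R) {μ : Measure (EuclideanSpace ℝ (Fin d))}
    [IsProbabilityMeasure μ] (hμ : μ Eᶜ = 0) :
    mutualEnergy s μ μ ≠ 0 := by
  have hR : 0 < R := by
    by_contra h
    rw [Metric.ball_eq_empty.2 (not_lt.1 h), Set.subset_empty_iff] at hER
    simp [hER] at hμ
  have hmem : ∀ᵐ x ∂μ, x ∈ E := hμ
  have hle : ∫⁻ _, ∫⁻ _, ENNReal.ofReal (2 * R) ^ (-s) ∂μ ∂μ ≤ mutualEnergy s μ μ := by
    refine lintegral_mono_ae ?_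
    filter_upwards [hmem] with x hx
    refine lintegral_mono_ae ?_
    filter_upwards [hmem] with y hy
    rw [ENNReal.rpow_neg, ENNReal.rpow_neg]
    gcongr
    rw [edist_dist]
    gcongr
    have h1 := Metric.mem_ball.1 (hER hx)
    have h2 := Metric.mem_ball.1 (hER hy)
    linarith [dist_triangle_right x y 0]
  simp only [lintegral_const, measure_univ, mul_one] at hle
  refine (lt_of_lt_of_le ?_ hle).ne'
  exact ENNReal.rpow_pos (by simpa using hR) ENNReal.ofReal_ne_top

/-! ### Imitating measures of bounded density by sets -/

/-- The space splits into countably many measurable cells of small diameter, here as the fibres of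
a measurable map to `ℕ`, each close to a given point. -/
theorem exists_measurable_cell {d : ℕ} {η : ℝ} (hη : 0 < η) :
    ∃ (cell : EuclideanSpace ℝ (Fin d) → ℕ) (p : ℕ → EuclideanSpace ℝ (Fin d)),
      Measurable cell ∧ ∀ x, dist x (p (cell x)) < η := by
  classical
  have hex : ∀ x : EuclideanSpace ℝ (Fin d), ∃ n,
      dist x (TopologicalSpace.denseSeq (EuclideanSpace ℝ (Fin d)) n) < η := by
    intro x
    obtain ⟨n, hn⟩ :=
      (TopologicalSpace.denseRange_denseSeq (EuclideanSpace ℝ (Fin d))).exists_dist_lt x hη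
    exact ⟨n, hn⟩
  refine ⟨fun x => Nat.find (hex x), TopologicalSpace.denseSeq _, ?_, fun x => Nat.find_spec (hex x)⟩
  exact measurable_find hex fun n => Metric.isOpen_ball.measurableSet

/-- Every measure `μ` with density at most `M` on `E` can be imitated by a set: there is a
measurable `F ⊆ E` such that `M • volume.restrict F` gives each cell of a countable measurable
partition the same mass as `μ`. -/
theorem exists_subset_map_restrict_eq {d : ℕ} (hd : 0 < d)
    {E : Set (EuclideanSpace ℝ (Fin d))} (hE : MeasurableSet E) {R : ℝ}
    (hER : E ⊆ Metric.ball 0 R) {μ : Measure (EuclideanSpace ℝ (Fin d))} {M : ℝ≥0∞}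
    (hM0 : M ≠ 0) (hM : M ≠ ∞) (hμ : μ ≤ M • volume.restrict E)
    {cell : EuclideanSpace ℝ (Fin d) → ℕ} (hcell : Measurable cell) :
    ∃ F ⊆ E, MeasurableSet F ∧ (volume.restrict F).map cell = M⁻¹ • μ.map cell := by
  have hm : ∀ n, MeasurableSet (cell ⁻¹' {n}) := fun n => hcell (measurableSet_singleton n)
  have hT : ∀ n, ∃ T ⊆ E ∩ cell ⁻¹' {n}, MeasurableSet T ∧ volume T = M⁻¹ * μ (cell ⁻¹' {n}) := by
    intro n
    refine exists_measurable_subset_volume_eq hd (hE.inter (hm n))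
      (Set.inter_subset_left.trans hER) ?_
    rw [ENNReal.inv_mul_le_iff hM0 hM]
    refine (hμ _).trans_eq ?_
    rw [Measure.smul_apply, smul_eq_mul, Measure.restrict_apply (hm n), Set.inter_comm]
  choose T hTE hTm hTv using hT
  refine ⟨⋃ n, T n, Set.iUnion_subset fun n => (hTE n).trans Set.inter_subset_left,
    MeasurableSet.iUnion hTm, Measure.ext_of_singleton fun n => ?_⟩
  rw [Measure.map_apply hcell (measurableSet_singleton n), Measure.restrict_apply (hm n),
    Measure.smul_apply, smul_eq_mul, Measure.map_apply hcell (measurableSet_singleton n), ← hTv]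
  congr 1
  ext x
  simp only [Set.mem_inter_iff, Set.mem_preimage, Set.mem_singleton_iff, Set.mem_iUnion]
  constructor
  · rintro ⟨hx, m, hxm⟩
    have := (hTE m hxm).2
    simp only [Set.mem_preimage, Set.mem_singleton_iff] at this
    rwa [← hx, this]
  · exact fun hx => ⟨(hTE n hx).2, n, hx⟩

/-- If two measures give the same masses to the cells of a partition of mesh `η`, then the
energy of one is at most a constant times that of the other, plus the contribution of the pairs at
distance less than `4 η`. -/
theorem mutualEnergy_self_le_of_map_eq {d : ℕ} {s : ℝ} (hs : 0 ≤ s) {η : ℝ} (hη : 0 < η)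
    {cell : EuclideanSpace ℝ (Fin d) → ℕ} {p : ℕ → EuclideanSpace ℝ (Fin d)}
    (hcell : Measurable cell) (hp : ∀ x, dist x (p (cell x)) < η)
    {μ ν : Measure (EuclideanSpace ℝ (Fin d))} (h : ν.map cell = μ.map cell) :
    mutualEnergy s ν ν ≤ 2 ^ s * mutualEnergy s μ μ +
      ∫⁻ x, ∫⁻ y in Metric.ball x (4 * η), edist y x ^ (-s) ∂ν ∂ν := by
  -- `κ` is constant on pairs of cells, below the kernel, and comparable to it for distant points.
  set κ : ℕ → ℕ → ℝ≥0∞ := fun m n => (edist (p m) (p n) + ENNReal.ofReal (2 * η)) ^ (-s) with hκ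
  have hpe : ∀ x, edist x (p (cell x)) ≤ ENNReal.ofReal η := fun x => by
    rw [edist_dist]; exact ENNReal.ofReal_le_ofReal (hp x).le
  have h2η : ENNReal.ofReal (2 * η) = ENNReal.ofReal η + ENNReal.ofReal η := by
    rw [← ENNReal.ofReal_add hη.le hη.le]; ring_nf
  have h4η : ENNReal.ofReal (4 * η) = ENNReal.ofReal (2 * η) + ENNReal.ofReal (2 * η) := by
    rw [← ENNReal.ofReal_add (by positivity) (by positivity)]; ring_nf
  have hlow : ∀ x y, κ (cell x) (cell y) ≤ edist x y ^ (-s) := by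
    intro x y
    simp only [hκ, ENNReal.rpow_neg]
    gcongr
    calc edist x y ≤ edist x (p (cell x)) + edist (p (cell x)) (p (cell y))
          + edist (p (cell y)) y := edist_triangle4 _ _ _ _
      _ ≤ ENNReal.ofReal η + edist (p (cell x)) (p (cell y)) + ENNReal.ofReal η := by
          gcongr
          · exact hpe x
          · rw [edist_comm]; exact hpe y
      _ = _ := by rw [h2η]; ring
  have hupp : ∀ x y, y ∉ Metric.ball x (4 * η) →
      edist x y ^ (-s) ≤ 2 ^ s * κ (cell x) (cell y) := by
    intro x y hy
    have hy' : ENNReal.ofReal (4 * η) ≤ edist x y := by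
      rw [edist_dist, dist_comm]
      exact ENNReal.ofReal_le_ofReal (by simpa using hy)
    have h1 : edist (p (cell x)) (p (cell y)) + ENNReal.ofReal (2 * η) ≤ 2 * edist x y := by
      calc edist (p (cell x)) (p (cell y)) + ENNReal.ofReal (2 * η)
          ≤ (edist (p (cell x)) x + edist x y + edist y (p (cell y)))
              + ENNReal.ofReal (2 * η) := by
            gcongr; exact edist_triangle4 _ _ _ _
        _ ≤ (ENNReal.ofReal η + edist x y + ENNReal.ofReal η) + ENNReal.ofReal (2 * η) := by
            gcongr
            · rw [edist_comm]; exact hpe x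
            · exact hpe y
        _ = ENNReal.ofReal (4 * η) + edist x y := by rw [h4η]; rw [h2η]; ring
        _ ≤ edist x y + edist x y := by gcongr
        _ = _ := by ring
    calc edist x y ^ (-s) = 2 ^ s * (2 * edist x y) ^ (-s) := by
          rw [ENNReal.mul_rpow_of_ne_top (by norm_num) (edist_ne_top _ _), ← mul_assoc,
            ← ENNReal.rpow_add _ _ (by norm_num) (by norm_num), add_neg_cancel,
            ENNReal.rpow_zero, one_mul]
      _ ≤ _ := by
          simp only [hκ, ENNReal.rpow_neg]
          gcongr
  have hsum : ∀ ρ : Measure (EuclideanSpace ℝ (Fin d)),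
      ∫⁻ x, ∫⁻ y, κ (cell x) (cell y) ∂ρ ∂ρ = ∫⁻ m, ∫⁻ n, κ m n ∂(ρ.map cell) ∂(ρ.map cell) := by
    intro ρ
    rw [lintegral_map (measurable_of_countable _) hcell]
    refine lintegral_congr fun x => ?_
    rw [lintegral_map (measurable_of_countable _) hcell]
  have hmeas : ∀ m, Measurable fun y => 2 ^ s * κ m (cell y) := fun m =>
    ((measurable_of_countable (κ m)).comp hcell).const_mul _
  calc mutualEnergy s ν ν
      ≤ ∫⁻ x, ((∫⁻ y, 2 ^ s * κ (cell x) (cell y) ∂ν) +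
          ∫⁻ y in Metric.ball x (4 * η), edist y x ^ (-s) ∂ν) ∂ν := by
        refine lintegral_mono fun x => ?_
        rw [← lintegral_indicator Metric.isOpen_ball.measurableSet,
          ← lintegral_add_left (hmeas _)]
        refine lintegral_mono fun y => ?_
        by_cases hy : y ∈ Metric.ball x (4 * η)
        · simp only [Set.indicator_of_mem hy, edist_comm y x]
          exact le_add_self
        · exact (hupp x y hy).trans le_self_add
    _ = 2 ^ s * ∫⁻ x, ∫⁻ y, κ (cell x) (cell y) ∂ν ∂ν +
          ∫⁻ x, ∫⁻ y in Metric.ball x (4 * η), edist y x ^ (-s) ∂ν ∂ν := by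
        have hF : Measurable fun m => ∫⁻ y, κ m (cell y) ∂ν := measurable_of_countable _
        have hc : ∀ m, Measurable fun y => κ m (cell y) := fun m =>
          (measurable_of_countable (κ m)).comp hcell
        simp only [lintegral_const_mul _ (hc _)]
        have hFc : Measurable fun x => ∫⁻ y, κ (cell x) (cell y) ∂ν := hF.comp hcell
        rw [lintegral_add_left (hFc.const_mul _), lintegral_const_mul _ hFc]
    _ ≤ _ := by
        rw [hsum, h, ← hsum, mutualEnergy]
        gcongr with x y
        exact hlow x y

/-- Passing from sets to measures with bounded density does not enlarge the energy capacity by more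
than a constant factor: a probability measure of bounded density on `E` is imitated, at a scale
so small that the close pairs contribute little energy, by a set `F ⊆ E`. -/
theorem one_le_GFun_mul_mutualEnergy {d : ℕ} {s : ℝ} (hs : 0 ≤ s) (hsd : s < d)
    {E : Set (EuclideanSpace ℝ (Fin d))} (hE : MeasurableSet E) {R : ℝ} (hR : 0 < R)
    (hER : E ⊆ Metric.ball 0 R) {μ : Measure (EuclideanSpace ℝ (Fin d))}
    [IsProbabilityMeasure μ] {M : ℝ≥0∞} (hM : M ≠ ∞) (hμ : μ ≤ M • volume.restrict E) :
    1 ≤ GFun s E * ((2 ^ s + 1) * mutualEnergy s μ μ) := by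
  have hd : 0 < d := by exact_mod_cast hs.trans_lt hsd
  have hM0 : M ≠ 0 := by
    rintro rfl
    have := hμ Set.univ
    simp at this
  have hμE : μ Eᶜ = 0 := le_antisymm ((hμ _).trans_eq (by
    rw [Measure.smul_apply, Measure.restrict_apply hE.compl]; simp)) zero_le
  have hI0 := mutualEnergy_self_ne_zero hs hER hμE
  have hI := mutualEnergy_ne_top_of_le hs hsd hR hER hM hM hμ hμ
  obtain ⟨C, hC, hCle⟩ := exists_setLIntegral_ball_edist_rpow_le (d := d) hs hsd
  obtain ⟨η, hη, hηle⟩ : ∃ η : ℝ, 0 < η ∧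
      M * (C * ENNReal.ofReal ((4 * η) ^ (d - s))) ≤ mutualEnergy s μ μ := by
    have hlim : Tendsto (fun η : ℝ => M * (C * ENNReal.ofReal ((4 * η) ^ (d - s)))) (𝓝 0)
        (𝓝 (M * (C * ENNReal.ofReal ((4 * 0) ^ (d - s))))) := by
      refine ENNReal.Tendsto.const_mul (ENNReal.Tendsto.const_mul ?_ (Or.inr hC)) (Or.inr hM)
      refine ENNReal.tendsto_ofReal ?_
      refine (Continuous.rpow_const (by fun_prop) fun _ => Or.inr (sub_pos.2 hsd).le).tendsto
        (0 : ℝ)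
    rw [mul_zero, Real.zero_rpow (sub_pos.2 hsd).ne', ENNReal.ofReal_zero, mul_zero, mul_zero]
      at hlim
    have := (hlim.mono_left nhdsWithin_le_nhds : Tendsto _ (𝓝[>] (0 : ℝ)) _).eventually
      (gt_mem_nhds hI0.bot_lt)
    obtain ⟨η, h1, h2⟩ := (this.and self_mem_nhdsWithin).exists
    exact ⟨η, h2, h1.le⟩
  obtain ⟨cell, p, hcell, hp⟩ := exists_measurable_cell (d := d) hη
  obtain ⟨F, hFE, hFm, hFmap⟩ := exists_subset_map_restrict_eq hd hE hER hM0 hM hμ hcell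
  have hMi : M⁻¹ ≠ 0 := ENNReal.inv_ne_zero.2 hM
  have hMi' : M⁻¹ ≠ ∞ := ENNReal.inv_ne_top.2 hM0
  have hvol : volume F = M⁻¹ := by
    have := congrArg (fun ρ => ρ Set.univ) hFmap
    simpa [Measure.map_apply hcell MeasurableSet.univ] using this
  have hsc : mutualEnergy s (M⁻¹ • μ) (M⁻¹ • μ) = M⁻¹ ^ 2 * mutualEnergy s μ μ := by
    simp only [mutualEnergy, lintegral_smul_measure, smul_eq_mul]
    rw [lintegral_const_mul _ ((measurable_edist_rpow (-s)).lintegral_prod_right')]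
    ring
  have henergy : setEnergy s F ≤ M⁻¹ ^ 2 * ((2 ^ s + 1) * mutualEnergy s μ μ) := by
    calc setEnergy s F = mutualEnergy s (volume.restrict F) (volume.restrict F) := rfl
      _ ≤ 2 ^ s * mutualEnergy s (M⁻¹ • μ) (M⁻¹ • μ) +
          ∫⁻ x in F, ∫⁻ y in Metric.ball x (4 * η), edist y x ^ (-s) ∂(volume.restrict F) :=
        mutualEnergy_self_le_of_map_eq hs hη hcell hp (by rw [hFmap, Measure.map_smul])
      _ ≤ 2 ^ s * (M⁻¹ ^ 2 * mutualEnergy s μ μ) +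
          ∫⁻ _ in F, C * ENNReal.ofReal ((4 * η) ^ (d - s)) := by
        rw [hsc]
        gcongr with x
        refine le_trans ?_ (hCle x (4 * η) (by positivity))
        exact lintegral_mono' (Measure.restrict_mono_measure Measure.restrict_le_self _) le_rfl
      _ = 2 ^ s * (M⁻¹ ^ 2 * mutualEnergy s μ μ) +
          M⁻¹ ^ 2 * (M * (C * ENNReal.ofReal ((4 * η) ^ (d - s)))) := by
        rw [setLIntegral_const, hvol]
        congr 1
        rw [sq, mul_assoc M⁻¹, ← mul_assoc _ M, ENNReal.inv_mul_cancel hM0 hM, one_mul, mul_comm]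
      _ ≤ 2 ^ s * (M⁻¹ ^ 2 * mutualEnergy s μ μ) + M⁻¹ ^ 2 * mutualEnergy s μ μ := by gcongr
      _ = _ := by ring
  have h2s : (2 : ℝ≥0∞) ^ s ≠ ∞ := ENNReal.rpow_ne_top_of_nonneg hs (by norm_num)
  have hJ0 : (2 ^ s + 1) * mutualEnergy s μ μ ≠ 0 := mul_ne_zero (by simp) hI0
  have hJ : (2 ^ s + 1) * mutualEnergy s μ μ ≠ ∞ := by finiteness
  have hg : gFun s F ≤ GFun s E :=
    le_iSup₂_of_le F ⟨hFE, hFm.nullMeasurableSet, by rw [hvol]; exact hMi.bot_lt⟩ le_rfl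
  rw [← ENNReal.div_le_iff hJ0 hJ]
  refine le_trans ?_ hg
  calc 1 / ((2 ^ s + 1) * mutualEnergy s μ μ)
      = M⁻¹ ^ 2 * 1 / (M⁻¹ ^ 2 * ((2 ^ s + 1) * mutualEnergy s μ μ)) := by
        rw [ENNReal.mul_div_mul_left _ _ (pow_ne_zero 2 hMi) (ENNReal.pow_ne_top hMi')]
    _ ≤ gFun s F := by
        rw [gFun, hvol, mul_one]
        gcongr

/-! ### Covering by balls of large mass -/

theorem hausdorffContent_le_tsum {d : ℕ} {t : ℝ} {ι : Type*} [Countable ι]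
    {E : Set (EuclideanSpace ℝ (Fin d))} {F : ι → Set (EuclideanSpace ℝ (Fin d))}
    (h : E ⊆ ⋃ i, F i) : hausdorffContent t E ≤ ∑' i, Metric.ediam (F i) ^ t := by
  obtain ⟨_⟩ := nonempty_encodable ι
  have hcov : E ⊆ ⋃ n, ⋃ b ∈ Encodable.decode₂ ι n, F b := by
    rwa [Encodable.iUnion_decode₂]
  unfold hausdorffContent
  refine iInf₂_le_of_le _ hcov ?_
  rw [tsum_iUnion_decode₂ (fun S => ⨆ _ : S.Nonempty, Metric.ediam S ^ t) (by simp) F]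
  exact ENNReal.tsum_le_tsum fun i => iSup_le fun _ => le_rfl

/-- The covering half of Frostman's lemma. The set function `m` is a pointwise limit of probability
measures, which makes it finitely additive; this is enough to sum the masses of the disjoint balls
given by Vitali's covering theorem. -/
theorem hausdorffContent_le_of_forall_exists_closedBall {d : ℕ} {t : ℝ} (ht : 0 ≤ t)
    {ι : Type*} {U : Filter ι} [U.NeBot] {μ : ι → Measure (EuclideanSpace ℝ (Fin d))}
    [∀ i, IsProbabilityMeasure (μ i)] {m : Set (EuclideanSpace ℝ (Fin d)) → ℝ≥0∞}
    (hm : ∀ B, Tendsto (fun i => μ i B) U (𝓝 (m B)))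
    {E : Set (EuclideanSpace ℝ (Fin d))} {K : ℝ≥0∞} {L : ℝ}
    (h : ∀ x ∈ E, ∃ r, 0 < r ∧ r ≤ L ∧ ENNReal.ofReal r ^ t ≤ K * m (Metric.closedBall x r)) :
    hausdorffContent t E ≤ 10 ^ t * K := by
  choose! r hr0 hrL hrm using h
  obtain ⟨u, huE, hdisj, hcov⟩ := Vitali.exists_disjoint_subfamily_covering_enlargement_closedBall
    E (fun x => x) r L hrL 5 (by norm_num)
  have hcount : u.Countable := hdisj.countable_of_nonempty_interior fun x hx => by
    refine ⟨x, Metric.ball_subset_interior_closedBall (Metric.mem_ball_self (hr0 x (huE hx)))⟩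
  have : Countable u := hcount.to_subtype
  have hsub : E ⊆ ⋃ b : u, Metric.closedBall (b : EuclideanSpace ℝ (Fin d)) (5 * r b) := by
    intro x hx
    obtain ⟨b, hb, hxb⟩ := hcov x hx
    exact Set.mem_iUnion.2 ⟨⟨b, hb⟩, hxb (Metric.mem_closedBall_self (hr0 x hx).le)⟩
  have hmass : ∑' b : u, m (Metric.closedBall (b : EuclideanSpace ℝ (Fin d)) (r b)) ≤ 1 := by
    rw [ENNReal.tsum_eq_iSup_sum]
    refine iSup_le fun T => ?_
    refine le_of_tendsto (tendsto_finsetSum T fun b _ => hm _) (Eventually.of_forall fun i => ?_)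
    rw [← measure_biUnion_finset]
    · exact prob_le_one
    · intro a _ b _ hab
      exact hdisj a.2 b.2 fun h => hab (Subtype.ext h)
    · exact fun b _ => Metric.isClosed_closedBall.measurableSet
  calc hausdorffContent t E
      ≤ ∑' b : u, Metric.ediam (Metric.closedBall (b : EuclideanSpace ℝ (Fin d)) (5 * r b)) ^ t :=
        hausdorffContent_le_tsum hsub
    _ ≤ ∑' b : u, 10 ^ t * K * m (Metric.closedBall (b : EuclideanSpace ℝ (Fin d)) (r b)) := by
        refine ENNReal.tsum_le_tsum fun b => ?_
        have hb := hr0 b (huE b.2)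
        calc Metric.ediam (Metric.closedBall (b : EuclideanSpace ℝ (Fin d)) (5 * r b)) ^ t
            ≤ (10 * ENNReal.ofReal (r b)) ^ t := by
              gcongr
              refine (Metric.ediam_le_of_forall_dist_le (C := 10 * r b) fun y hy z hz => ?_).trans_eq ?_
              · linarith [dist_triangle_right y z b, Metric.mem_closedBall.1 hy,
                  Metric.mem_closedBall.1 hz]
              · rw [ENNReal.ofReal_mul (by norm_num)]; norm_num
          _ = 10 ^ t * ENNReal.ofReal (r b) ^ t := ENNReal.mul_rpow_of_nonneg _ _ ht
          _ ≤ _ := by rw [mul_assoc]; gcongr; exact hrm b (huE b.2)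
    _ ≤ 10 ^ t * K := by
        rw [ENNReal.tsum_mul_left]
        exact mul_le_of_le_one_right zero_le hmass

/-! ### Mass near a point of positive lower density -/

/-- The radii `2 R 2⁻ᵏ` at which the mass near a point is measured. -/
noncomputable def dyadicRadius (R : ℝ) (k : ℕ) : ℝ := 2 * R * 2⁻¹ ^ k

theorem dyadicRadius_pos {R : ℝ} (hR : 0 < R) (k : ℕ) : 0 < dyadicRadius R k := by
  unfold dyadicRadius; positivity

theorem dyadicRadius_succ (R : ℝ) (k : ℕ) : dyadicRadius R (k + 1) = dyadicRadius R k / 2 := by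
  unfold dyadicRadius; ring

theorem dyadicRadius_antitone {R : ℝ} (hR : 0 < R) : Antitone (dyadicRadius R) :=
  antitone_nat_of_succ_le fun k => by
    rw [dyadicRadius_succ]; linarith [dyadicRadius_pos hR k]

theorem tendsto_dyadicRadius (R : ℝ) : Tendsto (dyadicRadius R) atTop (𝓝 0) := by
  have := (tendsto_pow_atTop_nhds_zero_of_lt_one (r := (2⁻¹ : ℝ)) (by norm_num)
    (by norm_num)).const_mul (2 * R)
  rwa [mul_zero] at this

theorem tsum_dyadicRadius_rpow_ne_top {R : ℝ} (hR : 0 < R) {a : ℝ} (ha : 0 < a) :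
    ∑' k, ENNReal.ofReal (dyadicRadius R k) ^ a ≠ ∞ := by
  have hk : ∀ k, ENNReal.ofReal (dyadicRadius R k) ^ a
      = ENNReal.ofReal (2 * R) ^ a * ((2⁻¹ : ℝ≥0∞) ^ a) ^ k := by
    intro k
    rw [dyadicRadius, ENNReal.ofReal_mul (by positivity), ENNReal.mul_rpow_of_nonneg _ _ ha.le,
      ENNReal.ofReal_pow (by norm_num), ENNReal.ofReal_inv_of_pos two_pos,
      ← ENNReal.rpow_natCast_mul, mul_comm (k : ℝ), ENNReal.rpow_mul_natCast]
    norm_num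
  simp only [hk]
  rw [ENNReal.tsum_mul_left, ENNReal.tsum_geometric]
  refine ENNReal.mul_ne_top (ENNReal.rpow_ne_top_of_nonneg ha.le ENNReal.ofReal_ne_top) ?_
  rw [ENNReal.inv_ne_top]
  exact (tsub_pos_of_lt (ENNReal.rpow_lt_one (by norm_num) ha)).ne'

/-- The mean potential of `μ` over a set `S` near `x` is controlled by the masses of the balls around
`x`: for a point `z` in a dyadic annulus around `x` the kernel is bounded on `S`, and for `z` in the
smallest ball only the local integrability of the kernel is used. -/
theorem mutualEnergy_cond_le {d : ℕ} {s : ℝ} (hs : 0 ≤ s) {R : ℝ} (hR : 0 < R) {C : ℝ≥0∞}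
    (hC : ∀ (z : EuclideanSpace ℝ (Fin d)) (r : ℝ), 0 < r →
      ∫⁻ y in Metric.ball z r, edist y z ^ (-s) ≤ C * ENNReal.ofReal (r ^ (d - s)))
    {μ : Measure (EuclideanSpace ℝ (Fin d))} [IsProbabilityMeasure μ]
    (hμ : μ (Metric.ball 0 R)ᶜ = 0) {x : EuclideanSpace ℝ (Fin d)} (hx : x ∈ Metric.ball 0 R)
    (N : ℕ) {S : Set (EuclideanSpace ℝ (Fin d))}
    (hSx : S ⊆ Metric.ball x (dyadicRadius R (N + 1))) (hS0 : volume S ≠ 0) :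
    mutualEnergy s (ProbabilityTheory.cond volume S) μ ≤
      (∑ k ∈ Finset.range N, ENNReal.ofReal (dyadicRadius R k / 4) ^ (-s) *
        μ (Metric.closedBall x (dyadicRadius R k))) +
      (volume S)⁻¹ * (C * ENNReal.ofReal ((4 * dyadicRadius R (N + 1)) ^ (d - s))) *
        μ (Metric.closedBall x (dyadicRadius R N)) := by
  have hSt : volume S ≠ ∞ := ((measure_mono hSx).trans_lt measure_ball_lt_top).ne
  have hSi : (volume S)⁻¹ * volume S = 1 := ENNReal.inv_mul_cancel hS0 hSt
  set r := dyadicRadius R with hr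
  have hmem : ∀ᵐ z ∂μ, z ∈ Metric.ball 0 R := hμ
  have hpt : ∀ z ∈ Metric.ball (0 : EuclideanSpace ℝ (Fin d)) R,
      (volume S)⁻¹ * ∫⁻ y in S, edist y z ^ (-s) ≤
      (∑ k ∈ Finset.range N, (Metric.closedBall x (r k)).indicator
        (fun _ => ENNReal.ofReal (r k / 4) ^ (-s)) z) +
      (Metric.closedBall x (r N)).indicator
        (fun _ => (volume S)⁻¹ * (C * ENNReal.ofReal ((4 * r (N + 1)) ^ (d - s)))) z := by
    intro z hz
    by_cases hzN : z ∈ Metric.closedBall x (r N)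
    · refine le_add_left ?_
      rw [Set.indicator_of_mem hzN]
      gcongr
      refine (lintegral_mono_set fun y hy => ?_).trans
        (hC z (4 * r (N + 1)) (by have := dyadicRadius_pos hR (N + 1); positivity))
      have h1 := Metric.mem_ball.1 (hSx hy)
      have h2 := Metric.mem_closedBall.1 hzN
      have h3 : r (N + 1) = r N / 2 := dyadicRadius_succ R N
      have h4 := dyadicRadius_pos hR N
      rw [Metric.mem_ball]
      linarith [dist_triangle_right y z x]
    · refine le_add_right ?_
      have hzN' : r N < dist z x := by simpa using hzN
      have hz0 : dist z x ≤ r 0 := by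
        have h1 := Metric.mem_ball.1 hx
        have h2 := Metric.mem_ball.1 hz
        have h3 : r 0 = 2 * R := by simp [hr, dyadicRadius]
        linarith [dist_triangle_right z x 0]
      obtain ⟨k, hkN, hk, hk1⟩ : ∃ k < N, dist z x ≤ r k ∧ r (k + 1) < dist z x := by
        classical
        have hex : ∃ k, r k < dist z x := ⟨N, hzN'⟩
        have h1 := Nat.find_spec hex
        have h2 := Nat.find_min' hex hzN'
        rcases hn : Nat.find hex with _ | j
        · rw [hn] at h1; exact absurd h1 (not_lt.2 hz0)
        · refine ⟨j, by omega, ?_, by rwa [hn] at h1⟩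
          exact not_lt.1 (Nat.find_min hex (m := j) (by omega))
      have hker : ∀ y ∈ S, edist y z ^ (-s) ≤ ENNReal.ofReal (r k / 4) ^ (-s) := by
        intro y hy
        rw [ENNReal.rpow_neg, ENNReal.rpow_neg]
        gcongr
        rw [edist_dist]
        gcongr
        have h1 := Metric.mem_ball.1 (hSx hy)
        have h2 : r (N + 1) ≤ r (k + 2) := dyadicRadius_antitone hR (by omega)
        have h3 : r (k + 2) = r (k + 1) / 2 := dyadicRadius_succ R (k + 1)
        have h4 : r (k + 1) = r k / 2 := dyadicRadius_succ R k
        linarith [dist_triangle_left z x y]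
      calc (volume S)⁻¹ * ∫⁻ y in S, edist y z ^ (-s)
          ≤ (volume S)⁻¹ * ∫⁻ _ in S, ENNReal.ofReal (r k / 4) ^ (-s) := by
            gcongr 1
            exact setLIntegral_mono measurable_const hker
        _ = ENNReal.ofReal (r k / 4) ^ (-s) := by
            rw [setLIntegral_const, mul_left_comm, hSi, mul_one]
        _ = (Metric.closedBall x (r k)).indicator
              (fun _ => ENNReal.ofReal (r k / 4) ^ (-s)) z := by
            rw [Set.indicator_of_mem (by simpa using hk)]
        _ ≤ _ := Finset.single_le_sum
            (f := fun k => (Metric.closedBall x (r k)).indicator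
              (fun _ => ENNReal.ofReal (r k / 4) ^ (-s)) z)
            (fun _ _ => zero_le) (Finset.mem_range.2 hkN)
  have hcl : ∀ ρ, MeasurableSet (Metric.closedBall x ρ) := fun ρ =>
    Metric.isClosed_closedBall.measurableSet
  calc mutualEnergy s (ProbabilityTheory.cond volume S) μ
      = ∫⁻ z, (volume S)⁻¹ * (∫⁻ y in S, edist y z ^ (-s)) ∂μ := by
        rw [mutualEnergy_comm, mutualEnergy]
        simp only [ProbabilityTheory.cond, lintegral_smul_measure, smul_eq_mul]
        simp only [edist_comm]
    _ ≤ _ := lintegral_mono_ae (by filter_upwards [hmem] with z hz using hpt z hz)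
    _ = _ := by
        rw [lintegral_add_right _ (measurable_const.indicator (hcl _)), lintegral_finsetSum _
          fun k _ => measurable_const.indicator (hcl _)]
        simp only [lintegral_indicator_const (hcl _)]

/-- If the limit `m` of the measures `μ i` had too little mass in all the dyadic balls around a point
`x` of positive lower density, then the mean potential over the part of `E` in a tiny ball around
`x` would be small. The density enters only through the term of the smallest ball, which tends to
`0` because `s < t`; so its value is irrelevant to the final constant. -/
theorem exists_le_mass_closedBall {d : ℕ} [NeZero d] {s t : ℝ} (hs : 0 ≤ s) (hst : s < t)
    {R : ℝ} (hR : 0 < R) {C : ℝ≥0∞} (hCt : C ≠ ∞)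
    (hC : ∀ (z : EuclideanSpace ℝ (Fin d)) (r : ℝ), 0 < r →
      ∫⁻ y in Metric.ball z r, edist y z ^ (-s) ≤ C * ENNReal.ofReal (r ^ (d - s)))
    {ι : Type*} {U : Filter ι} [U.NeBot] {μ : ι → Measure (EuclideanSpace ℝ (Fin d))}
    [∀ i, IsProbabilityMeasure (μ i)] (hμ : ∀ i, μ i (Metric.ball 0 R)ᶜ = 0)
    {m : Set (EuclideanSpace ℝ (Fin d)) → ℝ≥0∞}
    (hm : ∀ B, Tendsto (fun i => μ i B) U (𝓝 (m B)))
    {E : Set (EuclideanSpace ℝ (Fin d))}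
    {x : EuclideanSpace ℝ (Fin d)} (hx : x ∈ Metric.ball 0 R) {c : ℝ≥0∞} (hc : c ≠ 0)
    (hdens : ∀ᶠ ρ in 𝓝[>] (0 : ℝ),
      c ≤ volume (E ∩ Metric.ball x ρ) / volume (Metric.ball x ρ))
    {A : ℝ≥0∞} (hA0 : A ≠ 0) (hA : A ≠ ∞)
    (hpot : ∀ ρ : ℝ, volume (E ∩ Metric.ball x ρ) ≠ 0 → ∀ᶠ i in U,
      A ≤ mutualEnergy s (ProbabilityTheory.cond volume (E ∩ Metric.ball x ρ)) (μ i))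
    {κ : ℝ≥0∞} (hκt : κ ≠ ∞)
    (hκ : κ * (4 ^ s * ∑' k, ENNReal.ofReal (dyadicRadius R k) ^ (t - s)) ≤ 4⁻¹) :
    ∃ k, κ * A * ENNReal.ofReal (dyadicRadius R k) ^ t ≤
      m (Metric.closedBall x (dyadicRadius R k)) := by
  by_contra! hlt
  set r := dyadicRadius R with hr
  have hr0 : ∀ k, 0 < r k := dyadicRadius_pos hR
  set v := volume (Metric.ball (0 : EuclideanSpace ℝ (Fin d)) 1) with hv
  have hv0 : v ≠ 0 := (Metric.measure_ball_pos _ _ one_pos).ne'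
  have hvt : v ≠ ∞ := measure_ball_lt_top.ne
  have hci : c⁻¹ ≠ ∞ := ENNReal.inv_ne_top.2 hc
  have hvi : v⁻¹ ≠ ∞ := ENNReal.inv_ne_top.2 hv0
  set D : ℝ≥0∞ := c⁻¹ * v⁻¹ * C * ENNReal.ofReal (4 ^ (d - s) * 2 ^ t) with hD
  have hDt : D ≠ ∞ := by finiteness
  -- The scale `r (N + 1)` sees the density and makes the term of the smallest ball small.
  obtain ⟨N, hNd, hNs⟩ : ∃ N, c ≤ volume (E ∩ Metric.ball x (r (N + 1))) /
      volume (Metric.ball x (r (N + 1))) ∧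
      κ * (D * ENNReal.ofReal (r (N + 1) ^ (t - s))) < 4⁻¹ := by
    have h1 : Tendsto (fun N => r (N + 1)) atTop (𝓝[>] 0) :=
      tendsto_nhdsWithin_iff.2 ⟨(tendsto_dyadicRadius R).comp (tendsto_add_atTop_nat 1),
        Eventually.of_forall fun N => hr0 _⟩
    have h2 : Tendsto (fun ρ : ℝ => κ * (D * ENNReal.ofReal (ρ ^ (t - s)))) (𝓝 0)
        (𝓝 (κ * (D * ENNReal.ofReal (0 ^ (t - s))))) := by
      refine ENNReal.Tendsto.const_mul (ENNReal.Tendsto.const_mul ?_ (Or.inr hDt)) (Or.inr hκt)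
      refine ENNReal.tendsto_ofReal ?_
      exact (Real.continuousAt_rpow_const 0 (t - s) (Or.inr (sub_pos.2 hst).le)).tendsto
    rw [Real.zero_rpow (sub_pos.2 hst).ne', ENNReal.ofReal_zero, mul_zero, mul_zero] at h2
    have h3 := h2.mono_left (nhdsWithin_le_nhds (s := Set.Ioi 0))
    exact ((h1.eventually hdens).and
      ((h3.comp h1).eventually (gt_mem_nhds (by simp)))).exists
  set ρ := r (N + 1) with hρ
  have hρ0 : 0 < ρ := hr0 _
  have hrN : r N = 2 * ρ := by
    have : ρ = r N / 2 := dyadicRadius_succ R N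
    linarith
  set S := E ∩ Metric.ball x ρ with hS
  have hVle : c * (ENNReal.ofReal (ρ ^ d) * v) ≤ volume S := by
    have := ENNReal.mul_le_of_le_div hNd
    rwa [Measure.addHaar_ball_of_pos _ _ hρ0, finrank_euclideanSpace_fin] at this
  have hρd : ENNReal.ofReal (ρ ^ d) ≠ 0 := by simpa using pow_pos hρ0 d
  have hV0 : volume S ≠ 0 := by
    intro h
    rw [h, nonpos_iff_eq_zero] at hVle
    simp [hc, hv0, hρd] at hVle
  have hVi : (volume S)⁻¹ ≤ c⁻¹ * v⁻¹ * (ENNReal.ofReal (ρ ^ d))⁻¹ := by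
    have h1 := ENNReal.inv_le_inv.2 hVle
    rwa [ENNReal.mul_inv (Or.inl hc) (Or.inr (by simp [hρd, hv0])),
      ENNReal.mul_inv (Or.inl hρd) (Or.inr hv0), mul_comm _ v⁻¹, ← mul_assoc] at h1
  have hlim : A ≤ (∑ k ∈ Finset.range N, ENNReal.ofReal (r k / 4) ^ (-s) *
        m (Metric.closedBall x (r k))) +
      (volume S)⁻¹ * (C * ENNReal.ofReal ((4 * ρ) ^ (d - s))) * m (Metric.closedBall x (r N)) := by
    have hfin : ∀ k, ENNReal.ofReal (r k / 4) ^ (-s) ≠ ∞ := fun k =>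
      ENNReal.rpow_ne_top_of_ne_zero (by simpa using hr0 k) ENNReal.ofReal_ne_top
    have hVit : (volume S)⁻¹ ≠ ∞ := ENNReal.inv_ne_top.2 hV0
    refine ge_of_tendsto (Tendsto.add (tendsto_finsetSum _ fun k _ =>
      ENNReal.Tendsto.const_mul (hm _) (Or.inr (hfin k)))
      (ENNReal.Tendsto.const_mul (hm _) (Or.inr (by finiteness)))) ?_
    filter_upwards [hpot ρ hV0] with i hi
    exact hi.trans (mutualEnergy_cond_le hs hR hC (hμ i) hx N Set.inter_subset_right hV0)
  have hterm : ∀ k, ENNReal.ofReal (r k / 4) ^ (-s) * (κ * A * ENNReal.ofReal (r k) ^ t) =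
      A * (κ * (4 ^ s * ENNReal.ofReal (r k) ^ (t - s))) := by
    intro k
    have h1 : ENNReal.ofReal (r k / 4) ^ (-s) = 4 ^ s * ENNReal.ofReal (r k) ^ (-s) := by
      rw [div_eq_inv_mul, ENNReal.ofReal_mul (by norm_num), ENNReal.ofReal_inv_of_pos (by norm_num),
        ENNReal.mul_rpow_of_ne_top (by simp) ENNReal.ofReal_ne_top, ENNReal.inv_rpow,
        ENNReal.rpow_neg, inv_inv]
      norm_num
    have h2 : ENNReal.ofReal (r k) ^ (t - s) =
        ENNReal.ofReal (r k) ^ (-s) * ENNReal.ofReal (r k) ^ t := by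
      rw [← ENNReal.rpow_add _ _ (by simpa using hr0 k) ENNReal.ofReal_ne_top, neg_add_eq_sub]
    rw [h1, h2]; ring
  have hlast : (volume S)⁻¹ * (C * ENNReal.ofReal ((4 * ρ) ^ (d - s))) *
      (κ * A * ENNReal.ofReal (r N) ^ t) ≤ A * (κ * (D * ENNReal.ofReal (ρ ^ (t - s)))) := by
    have h1 : (ENNReal.ofReal (ρ ^ d))⁻¹ * ENNReal.ofReal ((4 * ρ) ^ (d - s)) *
        ENNReal.ofReal (r N) ^ t =
        ENNReal.ofReal (4 ^ (d - s) * 2 ^ t) * ENNReal.ofReal (ρ ^ (t - s)) := by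
      rw [← ENNReal.ofReal_inv_of_pos (pow_pos hρ0 d), ENNReal.ofReal_rpow_of_pos (hr0 N),
        ← ENNReal.ofReal_mul (by positivity), ← ENNReal.ofReal_mul (by positivity),
        ← ENNReal.ofReal_mul (by positivity), hrN, Real.mul_rpow (by norm_num) hρ0.le,
        Real.mul_rpow (by norm_num) hρ0.le]
      congr 1
      have h2 : ρ ^ (t - s) = (ρ ^ d)⁻¹ * ρ ^ (d - s) * ρ ^ t := by
        rw [← Real.rpow_natCast, ← Real.rpow_neg hρ0.le, ← Real.rpow_add hρ0, ← Real.rpow_add hρ0]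
        ring_nf
      rw [h2]; ring
    calc (volume S)⁻¹ * (C * ENNReal.ofReal ((4 * ρ) ^ (d - s))) *
          (κ * A * ENNReal.ofReal (r N) ^ t)
        ≤ c⁻¹ * v⁻¹ * (ENNReal.ofReal (ρ ^ d))⁻¹ * (C * ENNReal.ofReal ((4 * ρ) ^ (d - s))) *
          (κ * A * ENNReal.ofReal (r N) ^ t) := by gcongr
      _ = A * (κ * (c⁻¹ * v⁻¹ * C * ((ENNReal.ofReal (ρ ^ d))⁻¹ *
          ENNReal.ofReal ((4 * ρ) ^ (d - s)) * ENNReal.ofReal (r N) ^ t))) := by ring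
      _ = _ := by rw [h1, hD]; ring
  have hfinal : A ≤ A * 2⁻¹ := by
    calc A ≤ _ := hlim
      _ ≤ (∑ k ∈ Finset.range N, ENNReal.ofReal (r k / 4) ^ (-s) *
            (κ * A * ENNReal.ofReal (r k) ^ t)) +
          (volume S)⁻¹ * (C * ENNReal.ofReal ((4 * ρ) ^ (d - s))) *
            (κ * A * ENNReal.ofReal (r N) ^ t) := by
          gcongr with k
          · exact (hlt k).le
          · exact (hlt N).le
      _ ≤ A * (κ * (4 ^ s * ∑' k, ENNReal.ofReal (r k) ^ (t - s))) +
          A * (κ * (D * ENNReal.ofReal (ρ ^ (t - s)))) := by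
          refine add_le_add ?_ hlast
          simp only [hterm, ← Finset.mul_sum]
          gcongr
          exact ENNReal.sum_le_tsum _
      _ ≤ A * 4⁻¹ + A * 4⁻¹ := by gcongr
      _ = A * 2⁻¹ := by
          rw [← mul_add]
          congr 1
          rw [← ENNReal.toReal_eq_toReal_iff' (by finiteness) (by finiteness),
            ENNReal.toReal_add (by finiteness) (by finiteness)]
          norm_num
  have : A * 2⁻¹ < A := by
    rw [← div_eq_mul_inv]; exact ENNReal.half_lt_self hA0 hA
  exact absurd hfinal (not_le.2 this)

/-! ### The energy capacity bounds the Hausdorff content -/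

theorem hausdorffContent_empty {d : ℕ} (t : ℝ) :
    hausdorffContent t (∅ : Set (EuclideanSpace ℝ (Fin d))) = 0 := by
  refine le_antisymm ?_ zero_le
  unfold hausdorffContent
  exact iInf₂_le_of_le (fun _ => ∅) (Set.empty_subset _) (by simp)

theorem GFun_mono {d : ℕ} (s : ℝ) {E E' : Set (EuclideanSpace ℝ (Fin d))} (h : E' ⊆ E) :
    GFun s E' ≤ GFun s E :=
  iSup₂_le fun F hF => le_iSup₂_of_le F ⟨hF.1.trans h, hF.2⟩ le_rfl

/-- Given finitely many subsets of positive measure of `E`, there is a probability measure on `E`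
whose mean potential over each of them is at least the reciprocal of the energy capacity, up to a
constant. -/
theorem exists_probabilityMeasure_forall_le_mutualEnergy_cond {d : ℕ} {s : ℝ} (hs : 0 ≤ s)
    (hsd : s < d) {E : Set (EuclideanSpace ℝ (Fin d))} (hE : MeasurableSet E) {R : ℝ}
    (hR : 0 < R) (hER : E ⊆ Metric.ball 0 R)
    (T : Finset {S : Set (EuclideanSpace ℝ (Fin d)) // S ⊆ E ∧ volume S ≠ 0})
    (hT : T.Nonempty) :
    ∃ μ : Measure (EuclideanSpace ℝ (Fin d)), IsProbabilityMeasure μ ∧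
      μ (Metric.ball 0 R)ᶜ = 0 ∧ ∀ S ∈ T,
        1 ≤ GFun s E * ((2 ^ s + 1) *
          mutualEnergy s (ProbabilityTheory.cond volume (S : Set (EuclideanSpace ℝ (Fin d)))) μ) := by
  have hvt : ∀ S : T, volume (S.1.1) ≠ ∞ := fun S =>
    ((measure_mono (S.1.2.1.trans hER)).trans_lt measure_ball_lt_top).ne
  set ν : T → Measure (EuclideanSpace ℝ (Fin d)) := fun S =>
    ProbabilityTheory.cond volume S.1.1 with hν
  have hνp : ∀ S, IsProbabilityMeasure (ν S) := fun S =>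
    ProbabilityTheory.cond_isProbabilityMeasure_of_finite S.1.2.2 (hvt S)
  have hνle : ∀ S : T, ν S ≤ (volume S.1.1)⁻¹ • volume.restrict E := fun S => by
    intro B
    simp only [hν, ProbabilityTheory.cond, Measure.smul_apply, smul_eq_mul]
    gcongr
    exact S.1.2.1
  have hνt : ∀ S : T, (volume S.1.1)⁻¹ ≠ ∞ := fun S => ENNReal.inv_ne_top.2 S.1.2.2
  have : Nonempty T := hT.to_subtype
  obtain ⟨a, ha, hle⟩ := exists_convexCombination_energy_le (s := s) ν fun S S' =>
    mutualEnergy_ne_top_of_le hs hsd hR hER (hνt S) (hνt S') (hνle S) (hνle S')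
  have hat : ∀ S, a S ≠ ∞ := fun S => ne_top_of_le_ne_top ENNReal.one_ne_top
    (ha ▸ Finset.single_le_sum (fun _ _ => zero_le) (Finset.mem_univ S))
  set μ := ∑ S, a S • ν S with hμ
  have hμp : IsProbabilityMeasure μ := ⟨by
    simp only [hμ, Measure.finsetSum_apply, Measure.smul_apply, measure_univ, smul_eq_mul, mul_one,
      ha]⟩
  set M : ℝ≥0∞ := ∑ S : T, a S * (volume S.1.1)⁻¹ with hM
  have hMt : M ≠ ∞ := ENNReal.sum_ne_top.2 fun S _ => ENNReal.mul_ne_top (hat S) (hνt S)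
  have hμle : μ ≤ M • volume.restrict E := by
    intro B
    simp only [hμ, hM, Measure.finsetSum_apply, Measure.smul_apply, smul_eq_mul, Finset.sum_mul,
      mul_assoc]
    gcongr with S
    exact hνle S B
  refine ⟨μ, hμp, ?_, fun S hS => ?_⟩
  · refine le_antisymm ((hμle _).trans_eq ?_) zero_le
    rw [Measure.smul_apply, Measure.restrict_apply Metric.isOpen_ball.measurableSet.compl,
      ((disjoint_compl_left (a := Metric.ball (0 : EuclideanSpace ℝ (Fin d)) R)).mono_right
        hER).inter_eq, measure_empty, smul_zero]
  · refine (one_le_GFun_mul_mutualEnergy hs hsd hE hR hER hMt hμle).trans ?_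
    gcongr
    exact hle ⟨S, hS⟩

/-- For sets of positive lower density at each of their points the energy capacity of order `s`
controls the Hausdorff content of every order `t > s`. -/
theorem exists_hausdorffContent_le_mul_GFun {d : ℕ} {s t : ℝ} (hs : 0 ≤ s) (hsd : s < d)
    (hst : s < t) {R : ℝ} (hR : 0 < R) :
    ∃ K : ℝ≥0∞, K ≠ ∞ ∧ ∀ E : Set (EuclideanSpace ℝ (Fin d)), NullMeasurableSet E volume →
      E ⊆ Metric.ball 0 R → positiveDensityPart E = E →
      hausdorffContent t E ≤ K * GFun s E := by
  have hd : NeZero d := ⟨by rintro rfl; exact absurd hsd (by simpa using hs)⟩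
  have ht : 0 ≤ t := hs.trans hst.le
  obtain ⟨C, hCt, hC⟩ := exists_setLIntegral_ball_edist_rpow_le (d := d) hs hsd
  set σ : ℝ≥0∞ := 4 ^ s * ∑' k, ENNReal.ofReal (dyadicRadius R k) ^ (t - s) with hσ
  have hσt : σ ≠ ∞ := ENNReal.mul_ne_top (ENNReal.rpow_ne_top_of_nonneg hs (by norm_num))
    (tsum_dyadicRadius_rpow_ne_top hR (sub_pos.2 hst))
  -- With this `κ` the sum over all dyadic radii contributes at most a quarter of the potential.
  set κ : ℝ≥0∞ := (4 * (σ + 1))⁻¹ with hκ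
  have hκt : κ ≠ ∞ := ENNReal.inv_ne_top.2 (by simp)
  have hκ0 : κ ≠ 0 := ENNReal.inv_ne_zero.2 (by finiteness)
  have hκσ : κ * σ ≤ 4⁻¹ := by
    rw [hκ, ENNReal.mul_inv (by simp) (by simp), mul_assoc]
    refine mul_le_of_le_one_right zero_le ?_
    rw [mul_comm, ← div_eq_mul_inv]
    exact ENNReal.div_le_of_le_mul (by rw [one_mul]; exact le_self_add)
  have h2s : (2 : ℝ≥0∞) ^ s + 1 ≠ ∞ :=
    ENNReal.add_ne_top.2 ⟨ENNReal.rpow_ne_top_of_nonneg hs (by norm_num), by norm_num⟩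
  have h2s0 : (2 : ℝ≥0∞) ^ s + 1 ≠ 0 := by simp
  have h10 : (10 : ℝ≥0∞) ^ t ≠ ∞ := ENNReal.rpow_ne_top_of_nonneg ht (by norm_num)
  have h10' : (10 : ℝ≥0∞) ^ t ≠ 0 := (ENNReal.rpow_pos (by norm_num) (by norm_num)).ne'
  have hκi : κ⁻¹ ≠ ∞ := ENNReal.inv_ne_top.2 hκ0
  have hκi0 : κ⁻¹ ≠ 0 := ENNReal.inv_ne_zero.2 hκt
  refine ⟨10 ^ t * (κ⁻¹ * (2 ^ s + 1)), by finiteness, fun E hEm hER hE => ?_⟩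
  rcases E.eq_empty_or_nonempty with rfl | ⟨x₀, hx₀⟩
  · rw [hausdorffContent_empty]; exact zero_le
  by_cases hGt : GFun s E = ∞
  · rw [hGt, ENNReal.mul_top (by positivity)]; exact le_top
  -- Intersecting with balls and testing needs a genuinely measurable set; it has the same densities.
  obtain ⟨E', hE'E, hE'm, hE'ae⟩ := hEm.exists_measurable_subset_ae_eq
  have hvol : ∀ x ρ, volume (E' ∩ Metric.ball x ρ) = volume (E ∩ Metric.ball x ρ) := fun x ρ =>
    measure_congr (hE'ae.inter (ae_eq_refl _))
  have hdens : ∀ x ∈ E, ∃ c : ℝ≥0∞, c ≠ 0 ∧ ∀ᶠ ρ in 𝓝[>] (0 : ℝ),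
      c ≤ volume (E' ∩ Metric.ball x ρ) / volume (Metric.ball x ρ) := by
    intro x hx
    rw [← hE] at hx
    obtain ⟨c, hc0, hc⟩ := exists_between hx.2
    refine ⟨c, hc0.ne', ?_⟩
    filter_upwards [eventually_lt_of_lt_liminf hc] with ρ hρ
    rw [hvol]; exact hρ.le
  -- The finite families of test sets, directed by inclusion, index the measures `μ T` below; the
  -- fixed member `S₀` keeps them nonempty.
  set ι := {S : Set (EuclideanSpace ℝ (Fin d)) // S ⊆ E' ∧ volume S ≠ 0} with hι
  obtain ⟨S₀⟩ : Nonempty ι := by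
    obtain ⟨c, hc0, hc⟩ := hdens x₀ hx₀
    obtain ⟨ρ, hρ⟩ := hc.exists
    refine ⟨⟨E' ∩ Metric.ball x₀ ρ, Set.inter_subset_left, fun h => hc0 ?_⟩⟩
    simpa [h] using hρ
  classical
  have hex := fun T : Finset ι => exists_probabilityMeasure_forall_le_mutualEnergy_cond hs hsd hE'm
    hR (hE'E.trans hER) (insert S₀ T) (Finset.insert_nonempty _ _)
  choose μ hμp hμR hμ using hex
  have hG0 : GFun s E' ≠ 0 := fun h => by
    simpa [h] using hμ ∅ S₀ (Finset.mem_insert_self _ _)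
  have hG't : GFun s E' ≠ ∞ := ne_top_of_le_ne_top hGt (GFun_mono s hE'E)
  set G := GFun s E' * (2 ^ s + 1) with hG
  have hGne0 : G ≠ 0 := mul_ne_zero hG0 h2s0
  have hGnet : G ≠ ∞ := ENNReal.mul_ne_top hG't h2s
  set U : Ultrafilter (Finset ι) := Ultrafilter.of atTop with hU
  have hlim : ∀ B : Set (EuclideanSpace ℝ (Fin d)), ∃ l,
      Tendsto (fun T => μ T B) (U : Filter (Finset ι)) (𝓝 l) := fun B =>
    ⟨_, (U.map fun T => μ T B).le_nhds_lim⟩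
  choose m hm using hlim
  have hball : ∀ x ∈ E, ∃ r, 0 < r ∧ r ≤ 2 * R ∧
      ENNReal.ofReal r ^ t ≤ κ⁻¹ * G * m (Metric.closedBall x r) := by
    intro x hx
    obtain ⟨c, hc0, hc⟩ := hdens x hx
    have hpot : ∀ ρ : ℝ, volume (E' ∩ Metric.ball x ρ) ≠ 0 → ∀ᶠ T in (U : Filter (Finset ι)),
        G⁻¹ ≤ mutualEnergy s (ProbabilityTheory.cond volume (E' ∩ Metric.ball x ρ)) (μ T) := by
      intro ρ hρ
      set S : ι := ⟨E' ∩ Metric.ball x ρ, Set.inter_subset_left, hρ⟩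
      have hev : ∀ᶠ T : Finset ι in (U : Filter (Finset ι)), {S} ≤ T :=
        Ultrafilter.of_le atTop (eventually_ge_atTop _)
      filter_upwards [hev] with T hT
      have h1 := hμ T S (Finset.mem_insert_of_mem (Finset.singleton_subset_iff.1 hT))
      rw [← mul_assoc, mul_comm] at h1
      rw [← one_div]
      exact ENNReal.div_le_of_le_mul h1
    obtain ⟨k, hk⟩ := exists_le_mass_closedBall hs hst hR hCt hC hμR hm (hER hx) hc0 hc
      (ENNReal.inv_ne_zero.2 hGnet) (ENNReal.inv_ne_top.2 hGne0) hpot hκt hκσ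
    refine ⟨dyadicRadius R k, dyadicRadius_pos hR k, ?_, ?_⟩
    · simpa [dyadicRadius] using dyadicRadius_antitone hR (Nat.zero_le k)
    · calc ENNReal.ofReal (dyadicRadius R k) ^ t
          = κ⁻¹ * G * (κ * G⁻¹ * ENNReal.ofReal (dyadicRadius R k) ^ t) := by
            rw [← mul_assoc, mul_mul_mul_comm, ENNReal.inv_mul_cancel hκ0 hκt,
              ENNReal.mul_inv_cancel hGne0 hGnet, one_mul, one_mul]
        _ ≤ _ := by gcongr
  calc hausdorffContent t E ≤ 10 ^ t * (κ⁻¹ * G) :=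
        hausdorffContent_le_of_forall_exists_closedBall ht hm hball
    _ = 10 ^ t * (κ⁻¹ * (2 ^ s + 1)) * GFun s E' := by rw [hG]; ring
    _ ≤ _ := by gcongr; exact GFun_mono s hE'E

/-! ### Comparison of the exponents -/

theorem contentExponent_eq {d : ℕ} (A : ℕ → Set (EuclideanSpace ℝ (Fin d)))
    (h : {t : ℝ | 0 ≤ t ∧ t ≤ d ∧ ∑' n, hausdorffContent t (A n) < ∞}.Nonempty) :
    contentExponent A =
      sInf {t : ℝ | 0 ≤ t ∧ t ≤ d ∧ ∑' n, hausdorffContent t (A n) < ∞} := by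
  rw [contentExponent, if_pos h]

theorem contentExponent_le_of_tsum_lt_top {d : ℕ} {A : ℕ → Set (EuclideanSpace ℝ (Fin d))} {t : ℝ}
    (ht : 0 ≤ t) (htd : t ≤ d) (h : ∑' n, hausdorffContent t (A n) < ∞) :
    contentExponent A ≤ t := by
  rw [contentExponent_eq A ⟨t, ht, htd, h⟩]
  exact csInf_le ⟨0, fun t ht => ht.1⟩ ⟨ht, htd, h⟩

theorem contentExponent_le_dim {d : ℕ} (A : ℕ → Set (EuclideanSpace ℝ (Fin d))) :
    contentExponent A ≤ d := by
  by_cases h : {t : ℝ | 0 ≤ t ∧ t ≤ d ∧ ∑' n, hausdorffContent t (A n) < ∞}.Nonempty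
  · obtain ⟨t, ht, htd, hsum⟩ := h
    exact (contentExponent_le_of_tsum_lt_top ht htd hsum).trans htd
  · rw [contentExponent, if_neg h]

theorem le_contentExponent {d : ℕ} {A : ℕ → Set (EuclideanSpace ℝ (Fin d))} {s : ℝ} (hsd : s ≤ d)
    (h : ∀ t, 0 ≤ t → t < s → ∑' n, hausdorffContent t (A n) = ∞) :
    s ≤ contentExponent A := by
  by_cases hne : {t : ℝ | 0 ≤ t ∧ t ≤ d ∧ ∑' n, hausdorffContent t (A n) < ∞}.Nonempty
  · rw [contentExponent_eq A hne]
    exact le_csInf hne fun t ht => not_lt.1 fun hts => ht.2.2.ne (h t ht.1 hts)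
  · rwa [contentExponent, if_neg hne]

theorem energyExponent_le_contentExponent {d : ℕ} {R : ℝ} (hR : 0 < R)
    {A : ℕ → Set (EuclideanSpace ℝ (Fin d))} (hsub : ∀ n, A n ⊆ Metric.ball 0 R) :
    energyExponent A ≤ contentExponent A := by
  have hediam : ∀ n, Metric.ediam (A n) ≤ ENNReal.ofReal (2 * R) := fun n =>
    Metric.ediam_le_of_forall_dist_le fun x hx y hy => by
      linarith [dist_triangle_right x y 0, Metric.mem_ball.1 (hsub n hx),
        Metric.mem_ball.1 (hsub n hy)]
  refine Real.sSup_le (fun s hs => le_contentExponent hs.2.1 fun t ht hts => ?_)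
    (le_contentExponent (Nat.cast_nonneg d) fun t ht ht' => absurd ht (not_le.2 ht'))
  by_contra hfin
  have hle : ∑' n, GFun s (A n) ≤
      ENNReal.ofReal (2 * R) ^ (s - t) * ∑' n, hausdorffContent t (A n) := by
    rw [← ENNReal.tsum_mul_left]
    exact ENNReal.tsum_le_tsum fun n => GFun_le_mul_hausdorffContent ht hts (by simpa using hR)
      ENNReal.ofReal_ne_top (hediam n)
  rw [hs.2.2, top_le_iff] at hle
  exact ENNReal.mul_ne_top (ENNReal.rpow_ne_top_of_nonneg (sub_pos.2 hts).le
    ENNReal.ofReal_ne_top) hfin hle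

theorem contentExponent_le_energyExponent {d : ℕ} {R : ℝ} (hR : 0 < R)
    {A : ℕ → Set (EuclideanSpace ℝ (Fin d))} (hmeas : ∀ n, NullMeasurableSet (A n) volume)
    (hsub : ∀ n, A n ⊆ Metric.ball 0 R) (hdens : ∀ n, positiveDensityPart (A n) = A n) :
    contentExponent A ≤ energyExponent A := by
  by_contra! hlt
  obtain ⟨s, hs1, hs2⟩ := exists_between hlt
  obtain ⟨t, hst, ht2⟩ := exists_between hs2
  have hs0 : 0 ≤ s := (Real.sSup_nonneg fun s hs => hs.1).trans hs1.le
  have hsd : s < d := hs2.trans_le (contentExponent_le_dim A)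
  have hsum : ∑' n, GFun s (A n) ≠ ∞ := fun h =>
    hs1.not_ge (le_csSup ⟨d, fun s hs => hs.2.1⟩ ⟨hs0, hsd.le, h⟩)
  obtain ⟨K, hK, hKle⟩ := exists_hausdorffContent_le_mul_GFun hs0 hsd hst hR
  refine ht2.not_ge (contentExponent_le_of_tsum_lt_top (hs0.trans hst.le)
    (ht2.le.trans (contentExponent_le_dim A)) ?_)
  calc ∑' n, hausdorffContent t (A n) ≤ ∑' n, K * GFun s (A n) :=
        ENNReal.tsum_le_tsum fun n => hKle _ (hmeas n) (hsub n) (hdens n)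
    _ = K * ∑' n, GFun s (A n) := ENNReal.tsum_mul_left
    _ < ∞ := (ENNReal.mul_ne_top hK hsum).lt_top

end CoveringExponents

theorem corollary3p11 {d : ℕ} (R : ℝ) (hR : 0 < R)
    (A : ℕ → Set (EuclideanSpace ℝ (Fin d)))
    (hmeas : ∀ n, NullMeasurableSet (A n) volume)
    (hsub : ∀ n, A n ⊆ Metric.ball 0 R)
    (hdens : ∀ n, CoveringExponents.positiveDensityPart (A n) = A n) :
    CoveringExponents.contentExponent A = CoveringExponents.energyExponent A :=
  le_antisymm (CoveringExponents.contentExponent_le_energyExponent hR hmeas hsub hdens)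
    (CoveringExponents.energyExponent_le_contentExponent hR hsub)
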